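/- **Setting.** Let $D\subset\mathbb R$ be convex and compact with nonempty interior, let $\nu$ be a finite Borel measure on $D$ with a strictly positive Lebesgue density, $\mathcal H=L^2(D,\nu)$ with norm $\|\cdot\|$ and a fixed orthonormal basis $(e_k)_{k\in\mathbb N}$. For a continuous $f\colon D\to\mathbb R$ put $\mathrm{Lip}(f)=\sup_{u\ne v}|f(u)-f(v)|/|u-v|$, and for $r\ge 0$ let $\mathcal U(r)\subset\mathcal H$ be the set of (classes of) continuous functions $f$ with $\|f\|_\infty+\mathrm{Lip}(f)\le r$. Let $\mathcal S\subseteq\bigcup_{r}\mathcal U(r)$ be a linear subspace of $\mathcal H$. Let $(X_t)_{t\in\mathbb Z}$ be a strictly stationary $\mathcal S$-valued process on a probability space with $X_t=\Psi(X_{t-1})+\epsilon_t$ a.s., where the $\epsilon_t$ are i.i.d., $\mathcal S$-valued, integrable with mean $0$, and $\epsilon_t$ is independent of $\sigma(X_s:s<t)$. Here $\Psi\colon\mathcal H\to\mathcal H$ is Lipschitz, $\Psi|_{\mathcal S}$ has a Lipschitz constant $L_\Psi<1$, and the functions $\Psi(x)$, $x\in\mathcal S$, have continuous versions with a common Lipschitz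 constant on $D$. For a kernel $K$, bandwidth $h>0$ and radii $(r_n)$ let $$\hat\Psi_{n,h}(x)=\frac{\sum_{t=1}^n K(h^{-1}\|X_t-x\|)\,X_{t+1}}{\sum_{t=1}^n K(h^{-1}\|X_t-x\|)}\ \text{ for } x\in\mathcal S\cap\mathcal U(r_n),\qquad \hat\Psi_{n,h}(x)=\frac1n\sum_{t=1}^n X_t\ \text{ for } x\in\mathcal S\setminus\mathcal U(r_n)$$ (the quotient is $0$ if its denominator vanishes). Fix $x_0\in\mathcal S$, $\alpha>0$, functions $\phi$ on $[0,\infty)$ with $\phi>0$ on $(0,\infty)$, $f_\epsilon\ge0$ on $\mathcal S$, $g_\epsilon(u,x)$, and positive bandwidth sequences $h=h_n$, $b=b_n$. Write $P_y(u)=\mathbb P(\|\epsilon_t-y\|\le u)$ and $f_X(x)=\mathbb E[f_\epsilon(x-\Psi(X_t))]$. Assume: * **Kernel.** $K=0$ off $[0,1]$, $K$ is $C^1$ on $[0,1]$ with $K'\le 0$ there, and $K(1)>0$. * **Small balls.** 1. There is $z_0\in\mathcal H$ with $P_y(u)\le P_{z_0}(u)$ for all $y\in\mathcal H$ and all sufficiently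 small $u>0$. $P_{x_0}(u)>0$ for all $u>0$, and for some $C$ and all sufficiently small $u>0$, $|P_{y_1}(u)-P_{y_2}(u)|/P_{x_0}(u)\le C\|y_1-y_2\|^\alpha$ for all $y_1,y_2\in\mathcal S$. For each $y\in\mathcal S$ there is $\tilde L$ with $[P_y(u+\eta)-P_y(u-\eta)]/P_y(u)\le\tilde L\,\eta/u$ for all sufficiently small $u>0$ and all $0<\eta<u$ (the quotient being read as $0$ if $P_y(u)=0$). 2. $P_x(u)=f_\epsilon(x)\phi(u)+g_\epsilon(u,x)$ for $x\in\mathcal S$, $u>0$, and for every $r$, $\sup_{x\in\mathcal S\cap\mathcal U(r)}|g_\epsilon(u,x)|=o(\phi(u))$ as $u\downarrow0$ and $\inf_{x\in\mathcal S\cap\mathcal U(r)}f_X(x)>0$. 3. For every $r$, almost surely as $n\to\infty$, $$\sup_{x\in\mathcal S\cap\mathcal U(r)}\Big\{\Big|\frac1n\sum_{t=1}^nf_\epsilon(x-\Psi(X_{t-1}))-f_X(x)\Big|+\frac1n\sum_{t=1}^n\frac{|g_\epsilon(h_n,x-\Psi(X_{t-1}))|}{\phi(h_n)}\Big\}\to0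 .$$ 4. $\sup_{u\in[0,1]}|\phi(su)/\phi(s)-\tau_0(u)|\to0$ as $s\downarrow0$ for some $\tau_0\colon[0,1]\to[0,1]$ that is continuous in a neighbourhood of $0$ with $\tau_0(0)=0$. * **Moments.** There are $a_0,a_1>0$ such that for all $m\in\mathbb N$ each of $\sum_{k>m}\mathbb E\langle X_t,e_k\rangle^2$, $\sum_{k>m}\mathbb E\langle\epsilon_t,e_k\rangle^2$ and $\sum_{k>m}\langle x_0,e_k\rangle^2$ is at most $a_0e^{-a_1m}$. There are $C$ and $\tilde H>1$ with $\mathbb E\|\epsilon_t\|^m\le C\,m!\,\tilde H^{m-2}$ for all $m\ge2$. * **Bandwidths.** As $n\to\infty$: $h,b\to0$, $h/b\to0$, $h(n\phi(h))^{1/2}\to L^*$ for some $L^*\in[0,\infty)$, $(n\phi(h))^{1/2}(\log n)^{-(2+\alpha)}\to\infty$, $[\phi(h)/\phi(b)](\log n)^2\to0$, $b(\log n)^{1/2}\to0$, $b^{1+\alpha}(n\phi(h))^{1/2}\to0$. **Claim.** There is a deterministic sequence $(r_n)\subset(0,\infty)$ with $r_n\to\infty$ such that $$\sup_{x\in\mathcal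 S\cap\mathcal U(r_n)}\|\hat\Psi_{n,b_n}(x)-\Psi(x)\|=o_p(1),$$ i.e. for every $\delta>0$ the (outer) probability that this supremum exceeds $\delta$ tends to $0$ as $n\to\infty$. -/

import Mathlib

open MeasureTheory ProbabilityTheory Filter Topology Set
open scoped ENNReal NNReal

noncomputable section

namespace FAR

/-- The Hilbert space `L²(ν)`. The measures `ν` used below are carried by a compact set `D ⊆ ℝ`,
so this is `L²(D, ν)`. -/
abbrev L2 (ν : Measure ℝ) := Lp ℝ 2 ν

instance instMeasurableSpaceL2 (ν : Measure ℝ) : MeasurableSpace (L2 ν) := borel _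

instance instBorelSpaceL2 (ν : Measure ℝ) : BorelSpace (L2 ν) := ⟨rfl⟩

/-- `ν` is a measure on `D` with a strictly positive density with respect to Lebesgue measure. -/
def HasPositiveDensityOn (D : Set ℝ) (ν : Measure ℝ) : Prop :=
  ∃ p : ℝ → ℝ≥0∞, Measurable p ∧ (∀ u ∈ D, 0 < p u) ∧ ν = (volume.restrict D).withDensity p

/-- The sup norm of `f` on `D`. -/
def supNormOn (D : Set ℝ) (f : ℝ → ℝ) : ℝ≥0∞ := ⨆ u ∈ D, ‖f u‖ₑ

/-- The smallest Lipschitz constant of `f` on `D`. -/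
def lipNormOn (D : Set ℝ) (f : ℝ → ℝ) : ℝ≥0∞ :=
  ⨆ u ∈ D, ⨆ v ∈ D, ⨆ _ : u ≠ v, ‖f u - f v‖ₑ / ‖u - v‖ₑ

/-- The set `U(r)` of (classes of) continuous functions on `D` for which the sum of the sup norm
and the Lipschitz constant is at most `r`. -/
def lipBall (D : Set ℝ) (ν : Measure ℝ) (r : ℝ) : Set (L2 ν) :=
  {x | ∃ f : ℝ → ℝ, ContinuousOn f D ∧ (x : ℝ → ℝ) =ᵐ[ν] f ∧
    supNormOn D f + lipNormOn D f ≤ ENNReal.ofReal r}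

/-- The weight `Δ_{h,t}(x) = K(‖X_t - x‖ / h)`. -/
def kernelWeight {Ω : Type*} {ν : Measure ℝ} (K : ℝ → ℝ) (X : ℤ → Ω → L2 ν)
    (h : ℝ) (t : ℤ) (x : L2 ν) (ω : Ω) : ℝ :=
  K (h⁻¹ * ‖X t ω - x‖)

open Classical in
/-- The kernel estimator of the regression operator from `X_1, …, X_{n+1}` with bandwidth `h`:
the Nadaraya-Watson estimator on `S ∩ U(r)`, the sample mean elsewhere. -/
def kernelEstimator {Ω : Type*} {ν : Measure ℝ} (D : Set ℝ) (S : Submodule ℝ (L2 ν))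
    (K : ℝ → ℝ) (X : ℤ → Ω → L2 ν) (r : ℝ) (n : ℕ) (h : ℝ) (ω : Ω) (x : L2 ν) : L2 ν :=
  if x ∈ (S : Set (L2 ν)) ∩ lipBall D ν r then
    (∑ t ∈ Finset.Icc 1 n, kernelWeight K X h (t : ℤ) x ω)⁻¹ •
      ∑ t ∈ Finset.Icc 1 n, kernelWeight K X h (t : ℤ) x ω • X ((t : ℤ) + 1) ω
  else
    (n : ℝ)⁻¹ • ∑ t ∈ Finset.Icc 1 n, X (t : ℤ) ω

/-- `X` is a strictly stationary, `S`-valued process with `X_t = Ψ(X_{t-1}) + ε_t`, driven by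
i.i.d. centred `S`-valued innovations, where `ε_t` is independent of the past of `X` before `t`. -/
structure IsStationaryFAR {Ω : Type*} [MeasurableSpace Ω] (P : Measure Ω) {ν : Measure ℝ}
    (S : Submodule ℝ (L2 ν)) (Ψ : L2 ν → L2 ν) (X ε : ℤ → Ω → L2 ν) : Prop where
  measurable_process : ∀ t, Measurable (X t)
  measurable_innov : ∀ t, Measurable (ε t)
  process_mem : ∀ t ω, X t ω ∈ S
  innov_mem : ∀ t ω, ε t ω ∈ S
  recursion : ∀ t, ∀ᵐ ω ∂P, X t ω = Ψ (X (t - 1) ω) + ε t ω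
  stationary : ∀ s : ℤ, P.map (fun ω (t : ℤ) => X (t + s) ω) = P.map (fun ω (t : ℤ) => X t ω)
  innov_indep : iIndepFun ε P
  innov_ident : ∀ t, IdentDistrib (ε t) (ε 0) P P
  innov_integrable : Integrable (ε 0) P
  innov_mean : ∫ ω, ε 0 ω ∂P = 0
  innov_indep_past : ∀ t : ℤ,
    Indep (MeasurableSpace.comap (ε t) inferInstance)
      (⨆ s : {s : ℤ // s < t}, MeasurableSpace.comap (X s) inferInstance) P

/-- The kernel vanishes off `[0,1]`, is continuously differentiable and nonincreasing on `[0,1]`,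
and is positive at `1`. -/
structure KernelCondition (K : ℝ → ℝ) : Prop where
  support : ∀ s, s ∉ Icc (0 : ℝ) 1 → K s = 0
  contDiffOn : ContDiffOn ℝ 1 K (Icc 0 1)
  deriv_nonpos : ∀ s ∈ Icc (0 : ℝ) 1, derivWithin K (Icc 0 1) s ≤ 0
  pos_one : 0 < K 1

/-- `Ψ` is Lipschitz, is a strict contraction on `S`, and the functions `Ψ(x)`, `x ∈ S`, have a
common Lipschitz constant on `D`. -/
structure OperatorCondition (D : Set ℝ) {ν : Measure ℝ} (S : Submodule ℝ (L2 ν))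
    (Ψ : L2 ν → L2 ν) : Prop where
  lipschitz : ∃ C : ℝ≥0, LipschitzWith C Ψ
  contraction : ∃ L : ℝ≥0, L < 1 ∧ LipschitzOnWith L Ψ S
  lip_bound : ∃ C : ℝ≥0, ∀ x ∈ S, ∃ f : ℝ → ℝ,
    ContinuousOn f D ∧ (Ψ x : ℝ → ℝ) =ᵐ[ν] f ∧ lipNormOn D f ≤ C

/-- The small ball probability `P(‖ε_t - y‖ ≤ u)`; it does not depend on `t`. -/
def smallBall {Ω : Type*} [MeasurableSpace Ω] (P : Measure Ω) {ν : Measure ℝ}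
    (ε : ℤ → Ω → L2 ν) (y : L2 ν) (u : ℝ) : ℝ :=
  P.real {ω | ‖ε 0 ω - y‖ ≤ u}

/-- `f_X(x) = E f_ε(x - Ψ(X_t))`; it does not depend on `t`. -/
def fX {Ω : Type*} [MeasurableSpace Ω] (P : Measure Ω) {ν : Measure ℝ}
    (Ψ : L2 ν → L2 ν) (X : ℤ → Ω → L2 ν) (fε : L2 ν → ℝ) (x : L2 ν) : ℝ :=
  ∫ ω, fε (x - Ψ (X 0 ω)) ∂P

/-- The conditions on the small ball probabilities, with reference point `x₀`, Hölder exponent `α`,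
bandwidth sequence `h`, and the decomposition `P(‖ε_t - x‖ ≤ u) = f_ε(x) φ(u) + g_ε(u, x)`. -/
structure SmallBallCondition {Ω : Type*} [MeasurableSpace Ω] (P : Measure Ω) (D : Set ℝ)
    {ν : Measure ℝ} (S : Submodule ℝ (L2 ν)) (Ψ : L2 ν → L2 ν) (X ε : ℤ → Ω → L2 ν)
    (x₀ : L2 ν) (α : ℝ) (φ : ℝ → ℝ) (fε : L2 ν → ℝ) (gε : ℝ → L2 ν → ℝ) (h : ℕ → ℝ) :
    Prop where
  maximal : ∃ z₀ : L2 ν, ∀ᶠ u in 𝓝[>] (0 : ℝ), ∀ y : L2 ν, smallBall P ε y u ≤ smallBall P ε z₀ u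
  ref_pos : ∀ u > 0, 0 < smallBall P ε x₀ u
  holder : ∃ C : ℝ, ∀ᶠ u in 𝓝[>] (0 : ℝ), ∀ y₁ ∈ S, ∀ y₂ ∈ S,
    |smallBall P ε y₁ u / smallBall P ε x₀ u - smallBall P ε y₂ u / smallBall P ε x₀ u|
      ≤ C * ‖y₁ - y₂‖ ^ α
  annulus : ∀ y ∈ S, ∃ L : ℝ, ∀ᶠ u in 𝓝[>] (0 : ℝ), ∀ η ∈ Ioo 0 u,
    (smallBall P ε y (u + η) - smallBall P ε y (u - η)) * (smallBall P ε y u)⁻¹ ≤ L * η * u⁻¹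
  phi_pos : ∀ u > 0, 0 < φ u
  f_nonneg : ∀ x ∈ S, 0 ≤ fε x
  decomposition : ∀ x ∈ S, ∀ u > 0, smallBall P ε x u = fε x * φ u + gε u x
  remainder : ∀ r : ℝ, ∀ δ > 0, ∀ᶠ u in 𝓝[>] (0 : ℝ),
    ∀ x ∈ (S : Set (L2 ν)) ∩ lipBall D ν r, |gε u x| ≤ δ * φ u
  fX_pos : ∀ r : ℝ, ∃ c > 0, ∀ x ∈ (S : Set (L2 ν)) ∩ lipBall D ν r, c ≤ fX P Ψ X fε x
  ergodic : ∀ r : ℝ, ∀ᵐ ω ∂P, ∀ δ > 0, ∀ᶠ n : ℕ in atTop,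
    ∀ x ∈ (S : Set (L2 ν)) ∩ lipBall D ν r,
      |(n : ℝ)⁻¹ * ∑ t ∈ Finset.Icc 1 n, fε (x - Ψ (X ((t : ℤ) - 1) ω)) - fX P Ψ X fε x|
        + (n : ℝ)⁻¹ * ∑ t ∈ Finset.Icc 1 n, |gε (h n) (x - Ψ (X ((t : ℤ) - 1) ω))| * (φ (h n))⁻¹
        ≤ δ
  ratio : ∃ τ₀ : ℝ → ℝ, MapsTo τ₀ (Icc 0 1) (Icc 0 1) ∧ τ₀ 0 = 0 ∧
    (∃ δ > 0, ContinuousOn τ₀ (Ico 0 δ)) ∧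
    TendstoUniformlyOn (fun s u => φ (s * u) / φ s) τ₀ (𝓝[>] (0 : ℝ)) (Icc 0 1)

/-- The moment conditions; `e` is the fixed orthonormal basis of `L²(ν)` and `x₀` the reference
point. -/
structure MomentCondition {Ω : Type*} [MeasurableSpace Ω] (P : Measure Ω) {ν : Measure ℝ}
    (e : HilbertBasis ℕ ℝ (L2 ν)) (X ε : ℤ → Ω → L2 ν) (x₀ : L2 ν) : Prop where
  tails : ∃ a₀ > 0, ∃ a₁ > 0, ∀ m : ℕ,
    (∑' k : {k : ℕ // m < k}, ∫⁻ ω, ‖inner ℝ (e k) (X 0 ω)‖ₑ ^ 2 ∂P)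
        ≤ ENNReal.ofReal (a₀ * Real.exp (-a₁ * m)) ∧
    (∑' k : {k : ℕ // m < k}, ∫⁻ ω, ‖inner ℝ (e k) (ε 0 ω)‖ₑ ^ 2 ∂P)
        ≤ ENNReal.ofReal (a₀ * Real.exp (-a₁ * m)) ∧
    (∑' k : {k : ℕ // m < k}, ‖inner ℝ (e k) x₀‖ₑ ^ 2)
        ≤ ENNReal.ofReal (a₀ * Real.exp (-a₁ * m))
  moments : ∃ C : ℝ, ∃ H > 1, ∀ m : ℕ, 2 ≤ m →
    Integrable (fun ω => ‖ε 0 ω‖ ^ m) P ∧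
      ∫ ω, ‖ε 0 ω‖ ^ m ∂P ≤ C * (m.factorial : ℝ) * H ^ (m - 2)

/-- The conditions on the bandwidth `h` and the oversmoothing bandwidth `b`. -/
structure BandwidthCondition (φ : ℝ → ℝ) (α : ℝ) (h b : ℕ → ℝ) : Prop where
  h_pos : ∀ n, 0 < h n
  b_pos : ∀ n, 0 < b n
  h_lim : Tendsto h atTop (𝓝 0)
  b_lim : Tendsto b atTop (𝓝 0)
  h_div_b : Tendsto (fun n => h n / b n) atTop (𝓝 0)
  rate : ∃ L : ℝ, 0 ≤ L ∧ Tendsto (fun n => h n * Real.sqrt (n * φ (h n))) atTop (𝓝 L)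
  growth : Tendsto (fun n : ℕ => Real.sqrt (n * φ (h n)) * (Real.log n) ^ (-(2 + α))) atTop atTop
  phi_ratio : Tendsto (fun n : ℕ => φ (h n) / φ (b n) * (Real.log n) ^ 2) atTop (𝓝 0)
  b_log : Tendsto (fun n : ℕ => b n * Real.sqrt (Real.log n)) atTop (𝓝 0)
  b_rate : Tendsto (fun n : ℕ => b n ^ (1 + α) * Real.sqrt (n * φ (h n))) atTop (𝓝 0)

end FAR

end

/-!
Stationarity of `X` and the lower bound on `f_X` give the law of `X₀` mass at least `c φ(u)` on
every ball of radius `u` around a point of `S ∩ U(r)`, for each fixed `r`. Hence, on the scale `κ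
b_n`, the set `S ∩ U(r)` has a net of `O(1 / φ(b_n)) ≤ n` points (`IsStationaryFAR.exists_net`).
Combined with the law of large numbers for `f_ε(z - Ψ(X_{t-1}))` at the points `z` of a fixed
finite net, the Hölder condition on the small ball probabilities shows that with high probability
the conditional probabilities, given the past, of visits to a ball of radius `b_n / 2` add up to at
least a multiple of `n φ(b_n)`, uniformly over the centre
(`IsStationaryFAR.eventually_le_sum_smallBall`). No entropy of the Lipschitz balls enters, and no
mixing: `ε_t` being independent of the past of `X`, compensated exponentials of functionals of
`(X_{t-1}, ε_t)` form a supermartingale (`IsAutoregression.lintegral_prod_le_one`). Hence the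
number of visits to a set lies between one half and twice the sum of the conditional probabilities,
and weighted sums of real functions of the innovations with almost nonpositive mean are almost
nonpositive, in both cases up to an error `O(s)` outside an event of probability `O(e^{-s})`. A
norm in the Hilbert space is reduced to finitely many such sums by `exists_scalar_majorants`: the
mean norm of the tail of `ε₀` beyond a fixed coordinate is small.

With `s = 2 log n`, which is negligible against `n φ(b_n)` by the bandwidth conditions
(`BandwidthCondition.eventually_log_le`), these inequalities hold at all points of the net at once.
Moving from a point of the net to a point at distance `κ b_n` changes the weights by `O(κ)`, except
on a shell of relative width `κ`, because the kernel jumps at the boundary of its support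
(`KernelBounds.norm_average_sub_le`). Shells are rarely visited since the annulus condition at `x₀`
controls the increments of `φ`, and the decomposition `P_x(u) = f_ε(x) φ(u) + g_ε(u, x)` carries
this to all other centres; likewise `φ` is doubling, and the maximal ball is at most of order `φ`
(`SmallBallCondition.regularSmallBalls`). The bias is at most a Lipschitz constant of `Ψ` times
`b_n`. This proves uniform consistency over `S ∩ U(r)` for every fixed `r`
(`IsStationaryFAR.eventually_measure_error_le`), and the radii `r_n` are obtained by letting `r`
grow slowly enough (`exists_slow_diagonal`).
-/

noncomputable section

namespace FAR

/-! ### Exponential inequalities for autoregressions -/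

/-- `X` is a functional autoregression `X_t = Ψ(X_{t-1}) + ε_t` with identically distributed
innovations, `ε_t` being independent of the past `(X_s)_{s < t}`. Neither stationarity nor a linear
structure beyond addition is involved; this is all that the exponential inequalities below use. -/
structure IsAutoregression {Ω H : Type*} [MeasurableSpace Ω] [MeasurableSpace H] [Add H]
    (P : Measure Ω) (Ψ : H → H) (X ε : ℤ → Ω → H) : Prop where
  measurable_process : ∀ t, Measurable (X t)
  measurable_innov : ∀ t, Measurable (ε t)
  measurable_operator : Measurable Ψ
  recursion : ∀ t, ∀ᵐ ω ∂P, X t ω = Ψ (X (t - 1) ω) + ε t ω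
  innov_ident : ∀ t, IdentDistrib (ε t) (ε 0) P P
  innov_indep_past : ∀ t : ℤ,
    Indep (MeasurableSpace.comap (ε t) inferInstance)
      (⨆ s : {s : ℤ // s < t}, MeasurableSpace.comap (X s) inferInstance) P

/-- The σ-algebra generated by `(X_s)_{s < t}`. -/
abbrev strictPast {Ω H : Type*} [MeasurableSpace H] (X : ℤ → Ω → H) (t : ℤ) : MeasurableSpace Ω :=
  ⨆ s : {s : ℤ // s < t}, MeasurableSpace.comap (X s) inferInstance

theorem measurable_strictPast {Ω H : Type*} [MeasurableSpace H] (X : ℤ → Ω → H) {s t : ℤ}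
    (hst : s < t) : Measurable[strictPast X t] (X s) :=
  Measurable.mono (comap_measurable (X s))
    (le_iSup (fun s : {s : ℤ // s < t} => MeasurableSpace.comap (X s) inferInstance) ⟨s, hst⟩)
    le_rfl

section Exponential

variable {Ω H : Type*} [MeasurableSpace Ω] {P : Measure Ω} [IsProbabilityMeasure P]
  [NormedAddCommGroup H] [MeasurableSpace H] [BorelSpace H] [SecondCountableTopology H]
  {Ψ : H → H} {X ε : ℤ → Ω → H}

/-- A nonnegative kernel `Φ` with `E Φ(v, ε₀) ≤ 1` for all `v` yields a supermartingale along the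
autoregression. -/
theorem IsAutoregression.lintegral_prod_le_one (hA : IsAutoregression P Ψ X ε)
    {Φ : H → H → ℝ≥0∞} (hΦ : Measurable (Function.uncurry Φ))
    (hint : ∀ v, ∫⁻ ω, Φ v (ε 0 ω) ∂P ≤ 1) (j : ℤ) (n : ℕ) :
    ∫⁻ ω, ∏ t ∈ Finset.Icc 1 n, Φ (X ((t : ℤ) + j) ω) (ε ((t : ℤ) + j + 1) ω) ∂P ≤ 1 := by
  induction n with
  | zero => simp
  | succ n ih =>
    set T : ℤ := (n : ℤ) + 1 + j with hT
    have hm : strictPast X (T + 1) ≤ ‹MeasurableSpace Ω› :=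
      iSup_le fun s => (hA.measurable_process s).comap_le
    -- Almost surely the innovations up to time `T` are functions of the past of `X`.
    let G : Ω → ℝ≥0∞ := fun ω => ∏ t ∈ Finset.Icc 1 n,
      Φ (X ((t : ℤ) + j) ω) (X ((t : ℤ) + j + 1) ω - Ψ (X ((t : ℤ) + j) ω))
    have hGm : Measurable[strictPast X (T + 1)] G := by
      refine Finset.measurable_prod _ fun t ht => ?_
      have ht' := (Finset.mem_Icc.1 ht).2
      have h1 : Measurable[strictPast X (T + 1)] (X ((t : ℤ) + j)) :=
        measurable_strictPast X (by omega)
      have h2 : Measurable[strictPast X (T + 1)] (X ((t : ℤ) + j + 1)) :=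
        measurable_strictPast X (by omega)
      exact hΦ.comp (h1.prodMk (h2.sub (hA.measurable_operator.comp h1)))
    have hae : ∀ᵐ ω ∂P, ∀ t : ℤ, X t ω = Ψ (X (t - 1) ω) + ε t ω :=
      ae_all_iff.2 hA.recursion
    have hG : (fun ω => ∏ t ∈ Finset.Icc 1 n, Φ (X ((t : ℤ) + j) ω) (ε ((t : ℤ) + j + 1) ω))
        =ᵐ[P] G := by
      filter_upwards [hae] with ω hω
      refine Finset.prod_congr rfl fun t _ => ?_
      rw [hω ((t : ℤ) + j + 1), add_sub_cancel_right, add_sub_cancel_left]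
    let V : Ω → ℝ≥0∞ × H := fun ω => (G ω, X T ω)
    have hVm : Measurable[strictPast X (T + 1)] V := hGm.prodMk (measurable_strictPast X (by omega))
    have hV : Measurable V := hVm.mono hm le_rfl
    have hε := hA.measurable_innov (T + 1)
    have hind : IndepFun V (ε (T + 1)) P :=
      (indep_of_indep_of_le_right (hA.innov_indep_past (T + 1)) hVm.comap_le).symm
    have hmap := (indepFun_iff_map_prod_eq_prod_map_map hV.aemeasurable hε.aemeasurable).1 hind
    have hF : Measurable fun q : (ℝ≥0∞ × H) × H => q.1.1 * Φ q.1.2 q.2 :=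
      measurable_fst.fst.mul
        (hΦ.comp ((measurable_snd.comp measurable_fst).prodMk measurable_snd))
    have := Measure.isProbabilityMeasure_map (μ := P) hε.aemeasurable
    have := Measure.isProbabilityMeasure_map (μ := P) hV.aemeasurable
    calc ∫⁻ ω, ∏ t ∈ Finset.Icc 1 (n + 1), Φ (X ((t : ℤ) + j) ω) (ε ((t : ℤ) + j + 1) ω) ∂P
        = ∫⁻ ω, G ω * Φ (X T ω) (ε (T + 1) ω) ∂P := by
          refine lintegral_congr_ae ?_
          filter_upwards [hG] with ω hω
          rw [Finset.prod_Icc_succ_top (by omega), hω, hT]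
          push_cast
          rfl
      _ = ∫⁻ q, q.1.1 * Φ q.1.2 q.2 ∂(P.map fun ω => (V ω, ε (T + 1) ω)) := by
          rw [lintegral_map hF (hV.prodMk hε)]
      _ = ∫⁻ v, ∫⁻ x, v.1 * Φ v.2 x ∂(P.map (ε (T + 1))) ∂(P.map V) := by
          rw [hmap, lintegral_prod _ hF.aemeasurable]
      _ ≤ ∫⁻ v, v.1 ∂(P.map V) := by
          refine lintegral_mono fun v => ?_
          have hΦv : Measurable (Φ v.2) := hΦ.comp measurable_prodMk_left
          rw [lintegral_const_mul _ hΦv, (hA.innov_ident (T + 1)).map_eq,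
            lintegral_map hΦv (hA.measurable_innov 0)]
          exact mul_le_of_le_one_right' (hint v.2)
      _ = ∫⁻ ω, G ω ∂P := by rw [lintegral_map measurable_fst hV]
      _ ≤ 1 := by rw [← lintegral_congr_ae hG]; exact ih

/-- Chernoff bound for additive functionals of an autoregression. -/
theorem IsAutoregression.measure_le_sum (hA : IsAutoregression P Ψ X ε)
    {a : H → H → ℝ} (ha : Measurable (Function.uncurry a))
    (hint : ∀ v, ∫⁻ ω, ENNReal.ofReal (Real.exp (a v (ε 0 ω))) ∂P ≤ 1) (j : ℤ) (n : ℕ) (s : ℝ) :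
    P {ω | s ≤ ∑ t ∈ Finset.Icc 1 n, a (X ((t : ℤ) + j) ω) (ε ((t : ℤ) + j + 1) ω)}
      ≤ ENNReal.ofReal (Real.exp (-s)) := by
  have hΦ : Measurable (Function.uncurry fun v x => ENNReal.ofReal (Real.exp (a v x))) :=
    (Real.measurable_exp.comp ha).ennreal_ofReal
  have key := hA.lintegral_prod_le_one hΦ hint j n
  have hmeas : Measurable fun ω => ∏ t ∈ Finset.Icc 1 n,
      ENNReal.ofReal (Real.exp (a (X ((t : ℤ) + j) ω) (ε ((t : ℤ) + j + 1) ω))) :=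
    Finset.measurable_prod _ fun t _ =>
      hΦ.comp ((hA.measurable_process _).prodMk (hA.measurable_innov _))
  have hmarkov := (mul_meas_ge_le_lintegral (μ := P) hmeas
    (ENNReal.ofReal (Real.exp s))).trans key
  have hset : {ω | s ≤ ∑ t ∈ Finset.Icc 1 n, a (X ((t : ℤ) + j) ω) (ε ((t : ℤ) + j + 1) ω)}
      ⊆ {ω | ENNReal.ofReal (Real.exp s) ≤ ∏ t ∈ Finset.Icc 1 n,
        ENNReal.ofReal (Real.exp (a (X ((t : ℤ) + j) ω) (ε ((t : ℤ) + j + 1) ω)))} := by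
    intro ω hω
    simp only [mem_ofPred_eq] at hω ⊢
    rw [← ENNReal.ofReal_prod_of_nonneg fun _ _ => (Real.exp_pos _).le, ← Real.exp_sum]
    exact ENNReal.ofReal_le_ofReal (Real.exp_le_exp.2 hω)
  have h0 : ENNReal.ofReal (Real.exp s) ≠ 0 := by simp [Real.exp_pos]
  calc _ ≤ _ := measure_mono hset
    _ ≤ (ENNReal.ofReal (Real.exp s))⁻¹ := by
        rw [ENNReal.le_inv_iff_mul_le, mul_comm]; exact hmarkov
    _ = _ := by rw [Real.exp_neg, ENNReal.ofReal_inv_of_pos (Real.exp_pos s)]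

/-- The one-step transition probability `P(Ψ(v) + ε₀ ∈ B)` of an autoregression. -/
def transitionProb (P : Measure Ω) (Ψ : H → H) (ε : ℤ → Ω → H) (B : Set H) (v : H) : ℝ :=
  P.real {ω | Ψ v + ε 0 ω ∈ B}

theorem IsAutoregression.measurable_transitionProb (hA : IsAutoregression P Ψ X ε) {B : Set H}
    (hB : MeasurableSet B) : Measurable (transitionProb P Ψ ε B) := by
  have : MeasurableSet {q : H × Ω | Ψ q.1 + ε 0 q.2 ∈ B} :=
    ((hA.measurable_operator.comp measurable_fst).add
      ((hA.measurable_innov 0).comp measurable_snd)) hB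
  exact (measurable_measure_prodMk_left this).ennreal_toReal

omit [IsProbabilityMeasure P] [SecondCountableTopology H] in
theorem IsAutoregression.measurableSet_transition (hA : IsAutoregression P Ψ X ε) {B : Set H}
    (hB : MeasurableSet B) (v : H) : MeasurableSet {ω | Ψ v + ε 0 ω ∈ B} :=
  ((hA.measurable_innov 0).const_add _) hB

omit [SecondCountableTopology H] in
/-- The moment generating function bound for Bernoulli variables that feeds the supermartingale: an
indicator with coefficient `c` is compensated by `d` times its conditional expectation. -/
theorem IsAutoregression.lintegral_exp_indicator_le_one (hA : IsAutoregression P Ψ X ε) {B : Set H}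
    (hB : MeasurableSet B) (v : H) {c d : ℝ}
    (hcd : ∀ q ∈ Icc (0 : ℝ) 1, 1 + q * (Real.exp c - 1) ≤ Real.exp (d * q)) :
    ∫⁻ ω, ENNReal.ofReal (Real.exp (B.indicator (fun _ => c) (Ψ v + ε 0 ω)
      - d * transitionProb P Ψ ε B v)) ∂P ≤ 1 := by
  set q := transitionProb P Ψ ε B v with hq
  have hBv := hA.measurableSet_transition hB v
  have hpt : ∀ ω, ENNReal.ofReal (Real.exp (B.indicator (fun _ => c) (Ψ v + ε 0 ω) - d * q))
      = ENNReal.ofReal (Real.exp (-(d * q))) *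
        (({ω | Ψ v + ε 0 ω ∈ B}.indicator (fun _ => ENNReal.ofReal (Real.exp c)) ω) +
          ({ω | Ψ v + ε 0 ω ∈ B}ᶜ.indicator (fun _ => 1) ω)) := by
    intro ω
    by_cases h : Ψ v + ε 0 ω ∈ B
    · simp only [indicator, mem_ofPred_eq, h, mem_compl_iff, if_true, not_true, if_false, add_zero]
      rw [← ENNReal.ofReal_mul (Real.exp_pos _).le, ← Real.exp_add]
      ring_nf
    · simp [indicator, h]
  have hq0 : 0 ≤ q := measureReal_nonneg
  have hq1 : q ≤ 1 := measureReal_le_one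
  have hPq : P {ω | Ψ v + ε 0 ω ∈ B} = ENNReal.ofReal q := by simp [hq, transitionProb]
  have hPq' : P {ω | Ψ v + ε 0 ω ∈ B}ᶜ = ENNReal.ofReal (1 - q) := by
    rw [prob_compl_eq_one_sub hBv, hPq, ENNReal.ofReal_sub _ hq0, ENNReal.ofReal_one]
  simp_rw [hpt]
  have hmeas : Measurable fun ω =>
      ({ω | Ψ v + ε 0 ω ∈ B}.indicator (fun _ => ENNReal.ofReal (Real.exp c)) ω) :=
    measurable_const.indicator hBv
  rw [lintegral_const_mul' _ _ ENNReal.ofReal_ne_top, lintegral_add_left hmeas,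
    lintegral_indicator_const hBv, lintegral_indicator_const hBv.compl, hPq, hPq', one_mul,
    ← ENNReal.ofReal_mul (Real.exp_pos _).le, ← ENNReal.ofReal_add (by positivity) (by linarith),
    ← ENNReal.ofReal_mul (Real.exp_pos _).le, ← ENNReal.ofReal_one]
  refine ENNReal.ofReal_le_ofReal ?_
  calc Real.exp (-(d * q)) * (Real.exp c * q + (1 - q))
      = Real.exp (-(d * q)) * (1 + q * (Real.exp c - 1)) := by ring
    _ ≤ Real.exp (-(d * q)) * Real.exp (d * q) :=
        mul_le_mul_of_nonneg_left (hcd q ⟨hq0, hq1⟩) (Real.exp_pos _).le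
    _ = 1 := by rw [← Real.exp_add]; simp

/-- Visits of an autoregression to `B` do not exceed twice the sum of the conditional
probabilities by more than `s`, up to probability `e^{-s}`. -/
theorem IsAutoregression.measure_visits_upper (hA : IsAutoregression P Ψ X ε) {B : Set H}
    (hB : MeasurableSet B) (n : ℕ) (s : ℝ) :
    P {ω | 2 * ∑ t ∈ Finset.Icc 1 n, transitionProb P Ψ ε B (X ((t : ℤ) - 1) ω) + s
        < ∑ t ∈ Finset.Icc 1 n, B.indicator (fun _ => (1 : ℝ)) (X (t : ℤ) ω)}
      ≤ ENNReal.ofReal (Real.exp (-s)) := by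
  have hae : ∀ᵐ ω ∂P, ∀ t : ℤ, X t ω = Ψ (X (t - 1) ω) + ε t ω := ae_all_iff.2 hA.recursion
  have ha : Measurable (Function.uncurry fun v x : H =>
      B.indicator (fun _ => (1 : ℝ)) (Ψ v + x) - 2 * transitionProb P Ψ ε B v) :=
    ((measurable_const.indicator hB).comp
      ((hA.measurable_operator.comp measurable_fst).add measurable_snd)).sub
      (((hA.measurable_transitionProb hB).comp measurable_fst).const_mul 2)
  refine (measure_mono_ae ?_).trans (hA.measure_le_sum ha
    (fun v => hA.lintegral_exp_indicator_le_one hB v (c := 1) (d := 2) fun q hq => ?_) (-1) n s)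
  · filter_upwards [hae] with ω hω h
    have h' : 2 * ∑ t ∈ Finset.Icc 1 n, transitionProb P Ψ ε B (X ((t : ℤ) - 1) ω) + s
        < ∑ t ∈ Finset.Icc 1 n, B.indicator (fun _ => (1 : ℝ)) (X (t : ℤ) ω) := h
    change s ≤ _
    rw [Finset.sum_sub_distrib, ← Finset.mul_sum]
    have : ∑ t ∈ Finset.Icc 1 n, B.indicator (fun _ => (1 : ℝ))
        (Ψ (X ((t : ℤ) + -1) ω) + ε ((t : ℤ) + -1 + 1) ω)
        = ∑ t ∈ Finset.Icc 1 n, B.indicator (fun _ => (1 : ℝ)) (X (t : ℤ) ω) :=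
      Finset.sum_congr rfl fun t _ => by rw [hω t, neg_add_cancel_right, sub_eq_add_neg]
    rw [this]
    simp only [← sub_eq_add_neg]
    linarith
  · have h1 : Real.exp 1 ≤ 3 := by linarith [Real.exp_one_lt_d9]
    have h2 : 2 * q + 1 ≤ Real.exp (2 * q) := Real.add_one_le_exp _
    nlinarith [hq.1]

/-- Visits of an autoregression to `B` do not fall below half the sum of the conditional
probabilities by more than `s`, up to probability `e^{-s}`. -/
theorem IsAutoregression.measure_visits_lower (hA : IsAutoregression P Ψ X ε) {B : Set H}
    (hB : MeasurableSet B) (n : ℕ) (s : ℝ) :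
    P {ω | ∑ t ∈ Finset.Icc 1 n, B.indicator (fun _ => (1 : ℝ)) (X (t : ℤ) ω)
        < (1 / 2) * ∑ t ∈ Finset.Icc 1 n, transitionProb P Ψ ε B (X ((t : ℤ) - 1) ω) - s}
      ≤ ENNReal.ofReal (Real.exp (-s)) := by
  have hae : ∀ᵐ ω ∂P, ∀ t : ℤ, X t ω = Ψ (X (t - 1) ω) + ε t ω := ae_all_iff.2 hA.recursion
  have ha : Measurable (Function.uncurry fun v x : H =>
      B.indicator (fun _ => (-1 : ℝ)) (Ψ v + x) - (-(1 / 2)) * transitionProb P Ψ ε B v) :=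
    ((measurable_const.indicator hB).comp
      ((hA.measurable_operator.comp measurable_fst).add measurable_snd)).sub
      (((hA.measurable_transitionProb hB).comp measurable_fst).const_mul _)
  refine (measure_mono_ae ?_).trans (hA.measure_le_sum ha
    (fun v => hA.lintegral_exp_indicator_le_one hB v (c := -1) (d := -(1 / 2)) fun q hq => ?_)
    (-1) n s)
  · filter_upwards [hae] with ω hω h
    have h' : ∑ t ∈ Finset.Icc 1 n, B.indicator (fun _ => (1 : ℝ)) (X (t : ℤ) ω)
        < (1 / 2) * ∑ t ∈ Finset.Icc 1 n, transitionProb P Ψ ε B (X ((t : ℤ) - 1) ω) - s := h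
    change s ≤ _
    rw [Finset.sum_sub_distrib, ← Finset.mul_sum]
    have : ∑ t ∈ Finset.Icc 1 n, B.indicator (fun _ => (-1 : ℝ))
        (Ψ (X ((t : ℤ) + -1) ω) + ε ((t : ℤ) + -1 + 1) ω)
        = - ∑ t ∈ Finset.Icc 1 n, B.indicator (fun _ => (1 : ℝ)) (X (t : ℤ) ω) := by
      rw [← Finset.sum_neg_distrib]
      refine Finset.sum_congr rfl fun t _ => ?_
      rw [hω t, neg_add_cancel_right, sub_eq_add_neg]
      by_cases hB' : Ψ (X ((t : ℤ) + -1) ω) + ε t ω ∈ B <;> simp [indicator, hB']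
    rw [this]
    simp only [← sub_eq_add_neg]
    linarith
  · have h1 : Real.exp (-1) ≤ 1 / 2 := by
      have : (2 : ℝ) ≤ Real.exp 1 := by linarith [Real.exp_one_gt_d9]
      rw [Real.exp_neg, one_div]
      exact inv_anti₀ (by norm_num) this
    have h2 : -(1 / 2) * q + 1 ≤ Real.exp (-(1 / 2) * q) := Real.add_one_le_exp _
    nlinarith [hq.1]

/-- Weighted sums of a function `ξ` of the innovations, the weights in `[0, 1]` being functions of
the preceding state, do not exceed `m` times the total weight by more than `s / l`, up to
probability `e^{-s}`. -/
theorem IsAutoregression.measure_weighted_sum (hA : IsAutoregression P Ψ X ε) {w ξ : H → ℝ}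
    (hw : Measurable w) (hw01 : ∀ v, w v ∈ Icc (0 : ℝ) 1) (hξ : Measurable ξ) {l m : ℝ}
    (hl : 0 < l)
    (hint : ∫⁻ ω, ENNReal.ofReal (Real.exp (l * ξ (ε 0 ω))) ∂P ≤ ENNReal.ofReal (1 + l * m))
    (hm : 0 ≤ m) (n : ℕ) (s : ℝ) :
    P {ω | m * ∑ t ∈ Finset.Icc 1 n, w (X (t : ℤ) ω) + s / l
        < ∑ t ∈ Finset.Icc 1 n, w (X (t : ℤ) ω) * ξ (ε ((t : ℤ) + 1) ω)}
      ≤ ENNReal.ofReal (Real.exp (-s)) := by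
  have ha : Measurable (Function.uncurry fun v x : H => l * (w v * ξ x) - l * (m * w v)) :=
    (((hw.comp measurable_fst).mul (hξ.comp measurable_snd)).const_mul l).sub
      (((hw.comp measurable_fst).const_mul m).const_mul l)
  refine (measure_mono ?_).trans (hA.measure_le_sum ha (fun v => ?_) 0 n s)
  · intro ω h
    have h' : m * ∑ t ∈ Finset.Icc 1 n, w (X (t : ℤ) ω) + s / l
        < ∑ t ∈ Finset.Icc 1 n, w (X (t : ℤ) ω) * ξ (ε ((t : ℤ) + 1) ω) := h
    change s ≤ _
    simp only [add_zero]
    rw [Finset.sum_sub_distrib, ← Finset.mul_sum, ← Finset.mul_sum, ← Finset.mul_sum, ← mul_sub]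
    have : s / l < ∑ t ∈ Finset.Icc 1 n, w (X (t : ℤ) ω) * ξ (ε ((t : ℤ) + 1) ω)
        - m * ∑ t ∈ Finset.Icc 1 n, w (X (t : ℤ) ω) := by linarith
    rw [div_lt_iff₀ hl] at this
    linarith
  · obtain ⟨hw0, hw1⟩ := hw01 v
    -- convexity of the exponential interpolates between the weights `0` and `1`
    have hpt : ∀ ω, ENNReal.ofReal (Real.exp (l * (w v * ξ (ε 0 ω)) - l * (m * w v)))
        ≤ ENNReal.ofReal (Real.exp (-(l * (m * w v)))) * (ENNReal.ofReal (1 - w v)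
          + ENNReal.ofReal (w v) * ENNReal.ofReal (Real.exp (l * ξ (ε 0 ω)))) := by
      intro ω
      rw [← ENNReal.ofReal_mul hw0, ← ENNReal.ofReal_add (by linarith) (by positivity),
        ← ENNReal.ofReal_mul (Real.exp_pos _).le]
      refine ENNReal.ofReal_le_ofReal ?_
      rw [sub_eq_neg_add, Real.exp_add]
      refine mul_le_mul_of_nonneg_left ?_ (Real.exp_pos _).le
      have := convexOn_exp.2 (mem_univ 0) (mem_univ (l * ξ (ε 0 ω)))
        (sub_nonneg.2 hw1) hw0 (by ring)
      simp only [smul_eq_mul, mul_zero, zero_add, Real.exp_zero, mul_one] at this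
      calc Real.exp (l * (w v * ξ (ε 0 ω))) = Real.exp (w v * (l * ξ (ε 0 ω))) := by ring_nf
        _ ≤ _ := this
    have hmeas : Measurable fun ω => ENNReal.ofReal (Real.exp (l * ξ (ε 0 ω))) :=
      (Real.measurable_exp.comp
        ((hξ.comp (hA.measurable_innov 0)).const_mul l)).ennreal_ofReal
    refine (lintegral_mono hpt).trans ?_
    rw [lintegral_const_mul' _ _ ENNReal.ofReal_ne_top, lintegral_add_left measurable_const,
      lintegral_const, measure_univ, mul_one, lintegral_const_mul _ hmeas]
    calc ENNReal.ofReal (Real.exp (-(l * (m * w v)))) * (ENNReal.ofReal (1 - w v)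
          + ENNReal.ofReal (w v) * ∫⁻ ω, ENNReal.ofReal (Real.exp (l * ξ (ε 0 ω))) ∂P)
        ≤ ENNReal.ofReal (Real.exp (-(l * (m * w v)))) * (ENNReal.ofReal (1 - w v)
          + ENNReal.ofReal (w v) * ENNReal.ofReal (1 + l * m)) := by gcongr
      _ = ENNReal.ofReal (Real.exp (-(l * (m * w v))) * (1 + l * (m * w v))) := by
          rw [← ENNReal.ofReal_mul hw0, ← ENNReal.ofReal_add (by linarith) (by positivity),
            ← ENNReal.ofReal_mul (Real.exp_pos _).le]
          ring_nf
      _ ≤ ENNReal.ofReal 1 := by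
          refine ENNReal.ofReal_le_ofReal ?_
          have h2 := Real.add_one_le_exp (l * (m * w v))
          calc Real.exp (-(l * (m * w v))) * (1 + l * (m * w v))
              ≤ Real.exp (-(l * (m * w v))) * Real.exp (l * (m * w v)) :=
                mul_le_mul_of_nonneg_left (by linarith) (Real.exp_pos _).le
            _ = 1 := by rw [← Real.exp_add]; simp
      _ = 1 := ENNReal.ofReal_one

end Exponential

/-! ### Exponential moments and reduction to real-valued sums -/

section ExponentialMoments

variable {Ω : Type*} [MeasurableSpace Ω] {P : Measure Ω} [IsProbabilityMeasure P]

/-- Bernstein's moment condition yields an exponential moment. -/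
theorem integrable_exp_of_moments {Y : Ω → ℝ} (hY : Measurable Y) (hY0 : ∀ ω, 0 ≤ Y ω)
    (hY1 : Integrable Y P) {C B : ℝ} (hB : 1 < B)
    (hmom : ∀ m : ℕ, 2 ≤ m → Integrable (fun ω => Y ω ^ m) P ∧
      ∫ ω, Y ω ^ m ∂P ≤ C * (m.factorial : ℝ) * B ^ (m - 2)) :
    Integrable (fun ω => Real.exp ((2 * B)⁻¹ * Y ω)) P := by
  set l : ℝ := (2 * B)⁻¹ with hl
  have hB0 : 0 < B := by linarith
  have hl0 : 0 < l := by positivity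
  have hEY : 0 ≤ ∫ ω, Y ω ∂P := integral_nonneg hY0
  set C₀ : ℝ := |C| + 1 + 2 * (l * ∫ ω, Y ω ∂P) with hC₀
  have hint : ∀ m : ℕ, Integrable (fun ω => (l * Y ω) ^ m / (m.factorial : ℝ)) P ∧
      ∫ ω, (l * Y ω) ^ m / (m.factorial : ℝ) ∂P ≤ C₀ * (1 / 2) ^ m := by
    intro m
    rcases Nat.lt_or_ge m 2 with h | h
    · interval_cases m
      · simp only [pow_zero, Nat.factorial_zero, Nat.cast_one, div_one, integral_const,
          probReal_univ, smul_eq_mul, mul_one]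
        exact ⟨integrable_const _, by rw [hC₀]; nlinarith [abs_nonneg C]⟩
      · simp only [pow_one, Nat.factorial_one, Nat.cast_one, div_one]
        refine ⟨hY1.const_mul l, ?_⟩
        rw [integral_const_mul]
        rw [hC₀]
        nlinarith [abs_nonneg C]
    · obtain ⟨h1, h2⟩ := hmom m h
      have heq : (fun ω => (l * Y ω) ^ m / (m.factorial : ℝ))
          = fun ω => (l ^ m / (m.factorial : ℝ)) * Y ω ^ m := by
        funext ω; rw [mul_pow]; ring
      rw [heq]
      refine ⟨h1.const_mul _, ?_⟩
      rw [integral_const_mul]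
      have hf : (0 : ℝ) < m.factorial := by positivity
      have hBm : B ^ (m - 2) ≤ B ^ m := pow_le_pow_right₀ hB.le (by omega)
      calc l ^ m / (m.factorial : ℝ) * ∫ ω, Y ω ^ m ∂P
          ≤ l ^ m / (m.factorial : ℝ) * (C * (m.factorial : ℝ) * B ^ (m - 2)) := by gcongr
        _ = C * (l ^ m * B ^ (m - 2)) := by field_simp
        _ ≤ |C| * (l ^ m * B ^ (m - 2)) := by gcongr; exact le_abs_self C
        _ ≤ |C| * (l ^ m * B ^ m) := by gcongr
        _ = |C| * (1 / 2) ^ m := by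
            rw [← mul_pow, hl]
            congr 2
            field_simp
        _ ≤ C₀ * (1 / 2) ^ m := by
            gcongr
            rw [hC₀]
            nlinarith [mul_nonneg hl0.le hEY]
  have hmeas : Measurable fun ω => Real.exp (l * Y ω) :=
    Real.measurable_exp.comp (hY.const_mul l)
  refine ⟨hmeas.aestronglyMeasurable, ?_⟩
  rw [hasFiniteIntegral_iff_ofReal (Eventually.of_forall fun ω => (Real.exp_pos _).le)]
  have hexp : ∀ ω, ENNReal.ofReal (Real.exp (l * Y ω))
      = ∑' m : ℕ, ENNReal.ofReal ((l * Y ω) ^ m / (m.factorial : ℝ)) := by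
    intro ω
    rw [← ENNReal.ofReal_tsum_of_nonneg (fun m => by have := hY0 ω; positivity)
      (Real.summable_pow_div_factorial _), Real.exp_eq_exp_ℝ, NormedSpace.exp_eq_tsum_div]
  simp_rw [hexp]
  rw [lintegral_tsum fun m =>
    (((hY.const_mul l).pow_const m).div_const _).ennreal_ofReal.aemeasurable]
  have hs : Summable fun m : ℕ => C₀ * (1 / 2 : ℝ) ^ m :=
    summable_geometric_two.mul_left C₀
  have hC₀0 : 0 ≤ C₀ := by rw [hC₀]; positivity
  calc ∑' m : ℕ, ∫⁻ ω, ENNReal.ofReal ((l * Y ω) ^ m / (m.factorial : ℝ)) ∂P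
      ≤ ∑' m : ℕ, ENNReal.ofReal (C₀ * (1 / 2) ^ m) := by
        refine ENNReal.tsum_le_tsum fun m => ?_
        rw [← ofReal_integral_eq_lintegral_ofReal (hint m).1
          (Eventually.of_forall fun ω => by have := hY0 ω; simp only [Pi.zero_apply]; positivity)]
        exact ENNReal.ofReal_le_ofReal (hint m).2
    _ = ENNReal.ofReal (∑' m : ℕ, C₀ * (1 / 2) ^ m) :=
        (ENNReal.ofReal_tsum_of_nonneg (fun m => by positivity) hs).symm
    _ < ∞ := ENNReal.ofReal_lt_top

/-- First-order expansion of the moment generating function at `0`, as an upper bound. -/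
theorem exists_lintegral_exp_le {Y Z : Ω → ℝ} (hZ : Measurable Z) {c l : ℝ} (hc : 0 < c)
    (hl : 0 < l) (hY : Integrable (fun ω => Real.exp (l * Y ω)) P)
    (hZY : ∀ ω, |Z ω| ≤ c * Y ω) {m δ : ℝ} (hm : ∫ ω, Z ω ∂P ≤ m) (hδ : 0 < δ) :
    ∃ t : ℝ, 0 < t ∧
      ∫⁻ ω, ENNReal.ofReal (Real.exp (t * Z ω)) ∂P ≤ ENNReal.ofReal (1 + t * (m + δ)) := by
  have hmem : ∀ t : ℝ, |t| < l / c → t ∈ integrableExpSet Z P := by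
    intro t ht
    refine hY.mono' (Real.measurable_exp.comp (hZ.const_mul t)).aestronglyMeasurable
      (Eventually.of_forall fun ω => ?_)
    rw [Real.norm_eq_abs, abs_of_pos (Real.exp_pos _), Real.exp_le_exp]
    have hY0 : 0 ≤ Y ω := by
      have := (abs_nonneg _).trans (hZY ω)
      exact nonneg_of_mul_nonneg_right this hc
    rw [lt_div_iff₀ hc] at ht
    calc t * Z ω ≤ |t * Z ω| := le_abs_self _
      _ = |t| * |Z ω| := abs_mul _ _
      _ ≤ |t| * (c * Y ω) := by gcongr; exact hZY ω
      _ = (|t| * c) * Y ω := by ring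
      _ ≤ l * Y ω := by gcongr
  have hball : Metric.ball (0 : ℝ) (l / c) ⊆ integrableExpSet Z P := fun t ht =>
    hmem t (by simpa [Real.norm_eq_abs] using ht)
  have h0 : (0 : ℝ) ∈ interior (integrableExpSet Z P) :=
    mem_interior.2 ⟨_, hball, Metric.isOpen_ball, Metric.mem_ball_self (by positivity)⟩
  have hder := hasDerivAt_mgf h0
  simp only [zero_mul, Real.exp_zero, mul_one] at hder
  have hlo := (hasDerivAt_iff_isLittleO.1 hder).def hδ
  have hnear : ∀ᶠ t in 𝓝[>] (0 : ℝ), t ∈ Metric.ball (0 : ℝ) (l / c) :=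
    nhdsWithin_le_nhds (Metric.ball_mem_nhds (0 : ℝ) (by positivity))
  have hpos : ∀ᶠ t in 𝓝[>] (0 : ℝ), t ∈ Ioi (0 : ℝ) := self_mem_nhdsWithin
  obtain ⟨t, ⟨ht1, ht2⟩, ht3⟩ :=
    (((hlo.filter_mono nhdsWithin_le_nhds).and hnear).and hpos).exists
  have ht0 : 0 < t := ht3
  refine ⟨t, ht0, ?_⟩
  rw [← ofReal_integral_eq_lintegral_ofReal (hball ht2)
    (Eventually.of_forall fun ω => (Real.exp_pos _).le)]
  refine ENNReal.ofReal_le_ofReal ?_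
  simp only [mgf_zero, sub_zero, smul_eq_mul, Real.norm_eq_abs, abs_of_pos ht0] at ht1
  have h1 := (abs_le.1 ht1).2
  have h2 : mgf Z P t = ∫ ω, Real.exp (t * Z ω) ∂P := rfl
  rw [← h2]
  nlinarith

variable {H : Type*} [NormedAddCommGroup H] [InnerProductSpace ℝ H] [CompleteSpace H]
  [MeasurableSpace H] [BorelSpace H] [SecondCountableTopology H]

omit [CompleteSpace H] [MeasurableSpace H] [BorelSpace H] [SecondCountableTopology H] in
theorem norm_sub_partialSum_le (e : HilbertBasis ℕ ℝ H) (m : ℕ) (v : H) :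
    ‖v - ∑ k ∈ Finset.range m, inner ℝ (e k) v • e k‖ ≤ 2 * ‖v‖ := by
  have h1 : ‖∑ k ∈ Finset.range m, inner ℝ (e k) v • e k‖ ≤ ‖v‖ := by
    refine le_of_sq_le_sq ?_ (norm_nonneg v)
    have h2 := e.orthonormal.sum_inner_products_le (s := Finset.range m) v
    have h3 : ‖∑ k ∈ Finset.range m, inner ℝ (e k) v • e k‖ ^ 2
        = ∑ k ∈ Finset.range m, ‖inner ℝ (e k) v‖ ^ 2 := by
      rw [← real_inner_self_eq_norm_sq, e.orthonormal.inner_sum]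
      refine Finset.sum_congr rfl fun k _ => ?_
      simp [sq]
    rw [h3]; exact h2
  calc _ ≤ ‖v‖ + ‖∑ k ∈ Finset.range m, inner ℝ (e k) v • e k‖ := norm_sub_le _ _
    _ ≤ 2 * ‖v‖ := by linarith

omit [SecondCountableTopology H] in
/-- A nonnegatively weighted sum of copies of a centred Hilbert space valued variable `Z` with an
exponential moment is controlled by finitely many real-valued weighted sums with almost
nonpositive drift: those of the first coordinates, with both signs, and that of the norm of the
remaining tail. -/
theorem exists_scalar_majorants (e : HilbertBasis ℕ ℝ H) {Z : Ω → H} (hZ : Measurable Z)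
    (hZ1 : Integrable Z P) (hZ0 : ∫ ω, Z ω ∂P = 0) {l : ℝ} (hl : 0 < l)
    (hexp : Integrable (fun ω => Real.exp (l * ‖Z ω‖)) P) {δ : ℝ} (hδ : 0 < δ) :
    ∃ (ι : Type) (_ : Fintype ι) (ξ : ι → H → ℝ) (r : ι → ℝ),
      (∀ i, Measurable (ξ i)) ∧ (∀ i, 0 < r i) ∧
      (∀ i, ∫⁻ ω, ENNReal.ofReal (Real.exp (r i * ξ i (Z ω))) ∂P ≤ ENNReal.ofReal (1 + r i * δ)) ∧
      ∀ (s : Finset ℕ) (w : ℕ → ℝ) (v : ℕ → H) (a : ℝ), (∀ t ∈ s, 0 ≤ w t) →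
        (∀ i, ∑ t ∈ s, w t * ξ i (v t) ≤ a) → ‖∑ t ∈ s, w t • v t‖ ≤ 2 * a := by
  classical
  have htail : ∀ m, Continuous fun v : H => ‖v - ∑ k ∈ Finset.range m, inner ℝ (e k) v • e k‖ := by
    intro m; fun_prop
  have hlim : Tendsto (fun m => ∫ ω, ‖Z ω - ∑ k ∈ Finset.range m, inner ℝ (e k) (Z ω) • e k‖ ∂P)
      atTop (𝓝 (∫ _, (0 : ℝ) ∂P)) := by
    refine tendsto_integral_of_dominated_convergence (fun ω => 2 * ‖Z ω‖)
      (fun m => ((htail m).measurable.comp hZ).aestronglyMeasurable) (hZ1.norm.const_mul 2)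
      (fun m => Eventually.of_forall fun ω => ?_) (Eventually.of_forall fun ω => ?_)
    · rw [norm_norm]; exact norm_sub_partialSum_le e m (Z ω)
    · have h1 := (e.hasSum_repr (Z ω)).tendsto_sum_nat
      have h2 := (tendsto_const_nhds (x := Z ω)).sub h1
      rw [sub_self] at h2
      simpa [e.repr_apply_apply] using h2.norm
  rw [integral_zero] at hlim
  obtain ⟨m, hm⟩ := (hlim.eventually (eventually_lt_nhds (half_pos hδ))).exists
  let ξ : Option (Fin m × Bool) → H → ℝ := fun i v =>
    match i with
    | none => ‖v - ∑ k ∈ Finset.range m, inner ℝ (e k) v • e k‖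
    | some (k, true) => (m + 1 : ℝ) * inner ℝ (e k) v
    | some (k, false) => -((m + 1 : ℝ) * inner ℝ (e k) v)
  have hξm : ∀ i, Measurable (ξ i) := by
    rintro (_ | ⟨k, _ | _⟩)
    · exact (htail m).measurable
    · exact (show Continuous fun v : H => -((m + 1 : ℝ) * inner ℝ (e k) v) by fun_prop).measurable
    · exact (show Continuous fun v : H => (m + 1 : ℝ) * inner ℝ (e k) v by fun_prop).measurable
  have hcoord : ∀ (k : ℕ) (v : H), |(m + 1 : ℝ) * inner ℝ (e k) v| ≤ ((m : ℝ) + 2) * ‖v‖ := by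
    intro k v
    have h1 := abs_real_inner_le_norm (e k) v
    rw [e.orthonormal.1 k, one_mul] at h1
    rw [abs_mul, abs_of_nonneg (by positivity : (0 : ℝ) ≤ m + 1)]
    exact mul_le_mul (by linarith) h1 (abs_nonneg _) (by positivity)
  have hξb : ∀ i v, |ξ i v| ≤ ((m : ℝ) + 2) * ‖v‖ := by
    rintro (_ | ⟨k, _ | _⟩) v
    · change |‖v - ∑ k ∈ Finset.range m, inner ℝ (e k) v • e k‖| ≤ _
      rw [abs_norm]
      refine (norm_sub_partialSum_le e m v).trans ?_
      gcongr
      linarith [(Nat.cast_nonneg m : (0 : ℝ) ≤ m)]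
    · change |-((m + 1 : ℝ) * inner ℝ (e k) v)| ≤ _
      rw [abs_neg]; exact hcoord k v
    · exact hcoord k v
  have hmean : ∀ k : ℕ, ∫ ω, inner ℝ (e k) (Z ω) ∂P = 0 := by
    intro k
    rw [integral_inner hZ1, hZ0, inner_zero_right]
  have hξ0 : ∀ i, ∫ ω, ξ i (Z ω) ∂P ≤ δ / 2 := by
    rintro (_ | ⟨k, _ | _⟩)
    · exact hm.le
    · change ∫ ω, -((m + 1 : ℝ) * inner ℝ (e k) (Z ω)) ∂P ≤ _
      rw [integral_neg, integral_const_mul, hmean]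
      linarith
    · change ∫ ω, (m + 1 : ℝ) * inner ℝ (e k) (Z ω) ∂P ≤ _
      rw [integral_const_mul, hmean]
      linarith
  have hex := fun i => exists_lintegral_exp_le (P := P) ((hξm i).comp hZ)
    (by positivity : (0 : ℝ) < (m : ℝ) + 2) hl hexp (fun ω => hξb i (Z ω)) (hξ0 i) (half_pos hδ)
  choose r hr0 hr using hex
  refine ⟨Option (Fin m × Bool), inferInstance, ξ, r, hξm, hr0, fun i => ?_, ?_⟩
  · have := hr i
    rwa [add_halves] at this
  intro s w v a hw ha
  have hnone : ∑ t ∈ s, w t * ‖v t - ∑ k ∈ Finset.range m, inner ℝ (e k) (v t) • e k‖ ≤ a :=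
    ha none
  have ha0 : 0 ≤ a :=
    (Finset.sum_nonneg fun t ht => mul_nonneg (hw t ht) (norm_nonneg _)).trans hnone
  have hk : ∀ k ∈ Finset.range m, ‖inner ℝ (e k) (∑ t ∈ s, w t • v t) • e k‖ ≤ a / (m + 1) := by
    intro k hk
    rw [norm_smul, e.orthonormal.1 k, mul_one, Real.norm_eq_abs, inner_sum]
    simp only [inner_smul_right]
    have h1 : ∑ t ∈ s, w t * ((m + 1 : ℝ) * inner ℝ (e k) (v t)) ≤ a :=
      ha (some (⟨k, Finset.mem_range.1 hk⟩, true))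
    have h2 : ∑ t ∈ s, w t * -((m + 1 : ℝ) * inner ℝ (e k) (v t)) ≤ a :=
      ha (some (⟨k, Finset.mem_range.1 hk⟩, false))
    have h3 : ∑ t ∈ s, w t * ((m + 1 : ℝ) * inner ℝ (e k) (v t))
        = (∑ t ∈ s, w t * inner ℝ (e k) (v t)) * (m + 1) := by
      rw [Finset.sum_mul]; exact Finset.sum_congr rfl fun t _ => by ring
    have h4 : ∑ t ∈ s, w t * -((m + 1 : ℝ) * inner ℝ (e k) (v t))
        = -((∑ t ∈ s, w t * inner ℝ (e k) (v t)) * (m + 1)) := by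
      rw [← h3, ← Finset.sum_neg_distrib]; exact Finset.sum_congr rfl fun t _ => by ring
    have hm1 : (0 : ℝ) < m + 1 := by positivity
    rw [abs_le, ← neg_div, div_le_iff₀ hm1, le_div_iff₀ hm1]
    constructor <;> linarith
  have hsplit : ∑ t ∈ s, w t • v t
      = ∑ k ∈ Finset.range m, inner ℝ (e k) (∑ t ∈ s, w t • v t) • e k
        + ∑ t ∈ s, w t • (v t - ∑ k ∈ Finset.range m, inner ℝ (e k) (v t) • e k) := by
    simp only [smul_sub, Finset.sum_sub_distrib, Finset.smul_sum, inner_sum, Finset.sum_smul,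
      inner_smul_right, smul_smul]
    rw [Finset.sum_comm (s := Finset.range m)]
    abel
  rw [hsplit]
  refine (norm_add_le _ _).trans ?_
  have hA : ‖∑ k ∈ Finset.range m, inner ℝ (e k) (∑ t ∈ s, w t • v t) • e k‖ ≤ a := by
    refine (norm_sum_le_of_le _ hk).trans ?_
    rw [Finset.sum_const, Finset.card_range, nsmul_eq_mul, mul_div_assoc',
      div_le_iff₀ (by positivity)]
    nlinarith
  have hB : ‖∑ t ∈ s, w t • (v t - ∑ k ∈ Finset.range m, inner ℝ (e k) (v t) • e k)‖ ≤ a := by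
    refine (norm_sum_le _ _).trans (le_trans (le_of_eq ?_) hnone)
    refine Finset.sum_congr rfl fun t ht => ?_
    rw [norm_smul, Real.norm_of_nonneg (hw t ht)]
  linarith

end ExponentialMoments

/-! ### Regularity of small ball probabilities -/

theorem tendsto_const_mul_nhdsGT_zero {c : ℝ} (hc : 0 < c) :
    Tendsto (fun u : ℝ => c * u) (𝓝[>] 0) (𝓝[>] 0) := by
  refine tendsto_nhdsWithin_iff.2 ⟨?_, ?_⟩
  · have : Tendsto (fun u : ℝ => c * u) (𝓝 0) (𝓝 (c * 0)) := (continuous_const_mul c).tendsto 0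
    rw [mul_zero] at this
    exact this.mono_left nhdsWithin_le_nhds
  · filter_upwards [self_mem_nhdsWithin] with u hu
    exact mul_pos hc hu

theorem eventually_pos_nhdsGT_zero : ∀ᶠ u in 𝓝[>] (0 : ℝ), 0 < u := self_mem_nhdsWithin

theorem eventually_lt_nhdsGT_zero {c : ℝ} (hc : 0 < c) : ∀ᶠ u in 𝓝[>] (0 : ℝ), u < c :=
  nhdsWithin_le_nhds (eventually_lt_nhds hc)

/-- A monotone function whose increments over `[u - η, u + η]` are of relative order `η / u` is
doubling at `0`. -/
theorem eventually_doubling {p : ℝ → ℝ} (hmono : Monotone p) (hpos : ∀ u > 0, 0 < p u) {A : ℝ}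
    (hA : ∀ᶠ u in 𝓝[>] (0 : ℝ), ∀ η ∈ Ioo 0 u,
      (p (u + η) - p (u - η)) * (p u)⁻¹ ≤ A * η * u⁻¹) :
    ∃ C > 0, ∀ᶠ u in 𝓝[>] (0 : ℝ), p (2 * u) ≤ C * p u := by
  obtain ⟨u₀, hu₀, hsub⟩ := mem_nhdsGT_iff_exists_Ioo_subset.1 hA
  have hu₀' : 0 < u₀ := hu₀
  set B : ℝ := max A 1 with hB
  have hB1 : 1 ≤ B := le_max_right _ _
  set κ : ℝ := 1 / (2 * B) with hκ
  have hκ0 : 0 < κ := by positivity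
  have hκ1 : κ ≤ 1 / 2 := by rw [hκ]; gcongr; linarith
  -- `κ` is chosen so that the increment over `[(1 - κ) u, (1 + κ) u]` is at most `p u / 2`.
  have hstep : ∀ u ∈ Ioo 0 u₀, p ((1 + κ) * u) ≤ 2 * p ((1 - κ) * u) := by
    intro u hu
    have hu0 : 0 < u := hu.1
    have h1 := hsub hu (κ * u) ⟨by positivity, by nlinarith⟩
    have hpu := hpos u hu0
    have h2 : A * (κ * u) * u⁻¹ ≤ 1 / 2 := by
      have h3 : A * (κ * u) * u⁻¹ = A * κ := by field_simp
      rw [h3]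
      calc A * κ ≤ B * κ := by gcongr; exact le_max_left _ _
        _ = 1 / 2 := by rw [hκ]; field_simp
    have h3 := h1.trans h2
    rw [← div_eq_mul_inv, div_le_iff₀ hpu] at h3
    have h4 : p u ≤ p ((1 + κ) * u) := hmono (by nlinarith)
    have h5 : u + κ * u = (1 + κ) * u := by ring
    have h6 : u - κ * u = (1 - κ) * u := by ring
    rw [h5, h6] at h3
    linarith
  set θ : ℝ := (1 + κ) / (1 - κ) with hθ
  have hκ' : 0 < 1 - κ := by linarith
  have hθ1 : 1 < θ := by rw [hθ, lt_div_iff₀ hκ']; linarith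
  have hstep' : ∀ v, 0 < v → v < u₀ / 2 → p (θ * v) ≤ 2 * p v := by
    intro v hv hvu
    have h1 := hstep (v / (1 - κ)) ⟨by positivity, by rw [div_lt_iff₀ hκ']; nlinarith⟩
    have h2 : (1 + κ) * (v / (1 - κ)) = θ * v := by rw [hθ]; ring
    have h3 : (1 - κ) * (v / (1 - κ)) = v := by field_simp
    rwa [h2, h3] at h1
  have hiter : ∀ k : ℕ, ∀ v, 0 < v → θ ^ k * v < u₀ / 2 → p (θ ^ k * v) ≤ 2 ^ k * p v := by
    intro k
    induction k with
    | zero => intro v _ _; simp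
    | succ k ih =>
      intro v hv hvu
      have h0 : θ ^ k * v < u₀ / 2 := by
        refine lt_of_le_of_lt ?_ hvu
        gcongr
        · exact hθ1.le
        · omega
      have h1 := hstep' (θ ^ k * v) (by positivity) h0
      have h2 := ih v hv h0
      calc p (θ ^ (k + 1) * v) = p (θ * (θ ^ k * v)) := by ring_nf
        _ ≤ 2 * p (θ ^ k * v) := h1
        _ ≤ 2 * (2 ^ k * p v) := by linarith
        _ = 2 ^ (k + 1) * p v := by ring
  obtain ⟨k, hk⟩ := pow_unbounded_of_one_lt 2 hθ1
  refine ⟨2 ^ k, by positivity, ?_⟩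
  have hθk : 0 < θ ^ k := by positivity
  filter_upwards [eventually_pos_nhdsGT_zero,
    eventually_lt_nhdsGT_zero (by positivity : 0 < u₀ / 2 / θ ^ k)] with v hv hvu
  rw [lt_div_iff₀ hθk] at hvu
  exact (hmono (by gcongr)).trans (hiter k v hv (by linarith))

/-- The consequences of the small ball conditions that enter the consistency proof, for the
concentration function `p y u` of the innovations: everything is measured on the scale `φ`, and
`U r` are the sets over which the estimates are uniform. -/
structure RegularSmallBalls {H : Type*} [NormedAddCommGroup H] [Module ℝ H] (p : H → ℝ → ℝ)
    (S : Submodule ℝ H) (U : ℝ → Set H) (φ : ℝ → ℝ) (f : H → ℝ) (α : ℝ) : Prop where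
  phi_pos : ∀ u > 0, 0 < φ u
  doubling : ∃ C > 0, ∀ᶠ u in 𝓝[>] (0 : ℝ), φ (2 * u) ≤ C * φ u
  upper : ∃ B > 0, ∀ᶠ u in 𝓝[>] (0 : ℝ), ∀ y, p y u ≤ B * φ u
  density_bounds : ∃ B > 0, ∀ y ∈ S, f y ∈ Icc 0 B
  holder : ∃ C > 0, ∀ᶠ u in 𝓝[>] (0 : ℝ), ∀ y₁ ∈ S, ∀ y₂ ∈ S,
    p y₁ u ≤ p y₂ u + C * ‖y₁ - y₂‖ ^ α * φ u
  remainder : ∀ r : ℝ, ∀ δ > 0, ∀ᶠ u in 𝓝[>] (0 : ℝ), ∀ y ∈ (S : Set H) ∩ U r,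
    |p y u - f y * φ u| ≤ δ * φ u
  shell : ∀ r : ℝ, ∀ δ > 0, ∀ κ₀ > 0, ∃ κ ∈ Ioo (0 : ℝ) (1 / 2), κ ≤ κ₀ ∧ ∀ᶠ u in 𝓝[>] (0 : ℝ),
    ∀ y ∈ (S : Set H) ∩ U r, p y ((1 + κ) * u) - p y ((1 - κ) * u) ≤ δ * φ u

section SmallBalls

variable {Ω : Type*} [MeasurableSpace Ω] {P : Measure Ω} [IsProbabilityMeasure P] {ν : Measure ℝ}
  {ε : ℤ → Ω → L2 ν}

theorem smallBall_mono_radius (y : L2 ν) : Monotone (smallBall P ε y) := fun _ _ h =>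
  measureReal_mono fun _ hω => le_trans (α := ℝ) hω h

omit [IsProbabilityMeasure P] in
theorem smallBall_nonneg (y : L2 ν) (u : ℝ) : 0 ≤ smallBall P ε y u := measureReal_nonneg

theorem smallBall_le_of_norm_sub_le {y z : L2 ν} {u v w : ℝ} (h : ‖y - z‖ ≤ w) (huv : u + w ≤ v) :
    smallBall P ε y u ≤ smallBall P ε z v :=
  measureReal_mono fun ω hω => by
    have hω' : ‖ε 0 ω - y‖ ≤ u := hω
    change ‖ε 0 ω - z‖ ≤ v
    calc ‖ε 0 ω - z‖ = ‖(ε 0 ω - y) + (y - z)‖ := by rw [sub_add_sub_cancel]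
      _ ≤ ‖ε 0 ω - y‖ + ‖y - z‖ := norm_add_le _ _
      _ ≤ v := by linarith

omit [IsProbabilityMeasure P] in
/-- Along the process `Ψ` takes values in `S`, although it need not map `S` to itself. -/
theorem IsStationaryFAR.ae_operator_mem {S : Submodule ℝ (L2 ν)} {Ψ : L2 ν → L2 ν}
    {X : ℤ → Ω → L2 ν} (hX : IsStationaryFAR P S Ψ X ε) (t : ℤ) : ∀ᵐ ω ∂P, Ψ (X t ω) ∈ S := by
  filter_upwards [hX.recursion (t + 1)] with ω hω
  rw [add_sub_cancel_right] at hω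
  have : Ψ (X t ω) = X (t + 1) ω - ε (t + 1) ω := by rw [hω]; abel
  rw [this]
  exact S.sub_mem (hX.process_mem _ _) (hX.innov_mem _ _)

variable {D : Set ℝ} {S : Submodule ℝ (L2 ν)} {Ψ : L2 ν → L2 ν} {X : ℤ → Ω → L2 ν}
  {x₀ : L2 ν} {α : ℝ} {φ : ℝ → ℝ} {fε : L2 ν → ℝ} {gε : ℝ → L2 ν → ℝ} {h : ℕ → ℝ}

/-- On small scales no ball charges the innovations essentially more than those at `x₀`: the
maximal ball, if charged at all, meets `S`, so that it lies in a ball of twice the radius with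
centre in `S` at bounded distance from `x₀`. -/
theorem SmallBallCondition.eventually_smallBall_le (hX : IsStationaryFAR P S Ψ X ε)
    (hx₀ : x₀ ∈ S) (hα : 0 < α) (hball : SmallBallCondition P D S Ψ X ε x₀ α φ fε gε h) :
    ∃ B > 0, ∀ᶠ u in 𝓝[>] (0 : ℝ), ∀ y, smallBall P ε y u ≤ B * smallBall P ε x₀ u := by
  obtain ⟨A, hA⟩ := hball.annulus x₀ hx₀
  obtain ⟨C, hC, hdouble⟩ := eventually_doubling (smallBall_mono_radius x₀) hball.ref_pos hA
  obtain ⟨z₀, hmax⟩ := hball.maximal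
  obtain ⟨Ch, hCh⟩ := hball.holder
  set M : ℝ := 1 + |Ch| * (‖z₀ - x₀‖ + 1) ^ α with hM
  have hM0 : 0 < M := by positivity
  refine ⟨M * C, by positivity, ?_⟩
  filter_upwards [hdouble, hmax, (tendsto_const_mul_nhdsGT_zero two_pos).eventually hCh,
    eventually_pos_nhdsGT_zero, eventually_lt_nhdsGT_zero one_pos] with u h1 h2 h3 h4 h5 y
  refine (h2 y).trans ?_
  rcases (smallBall_nonneg (P := P) (ε := ε) z₀ u).eq_or_lt with h0 | h0
  · rw [← h0]
    exact mul_nonneg (by positivity) (smallBall_nonneg _ _)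
  have hne : {ω | ‖ε 0 ω - z₀‖ ≤ u}.Nonempty := by
    by_contra hcon
    rw [not_nonempty_iff_eq_empty] at hcon
    rw [smallBall, hcon, measureReal_empty] at h0
    exact lt_irrefl _ h0
  obtain ⟨ω, hω⟩ := hne
  have hω' : ‖ε 0 ω - z₀‖ ≤ u := hω
  have hr := hball.ref_pos (2 * u) (by linarith)
  have h6 := h3 (ε 0 ω) (hX.innov_mem 0 ω) x₀ hx₀
  rw [← sub_div, abs_div, abs_of_pos hr, div_le_iff₀ hr] at h6
  have h7 : ‖ε 0 ω - x₀‖ ≤ ‖z₀ - x₀‖ + 1 := by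
    calc ‖ε 0 ω - x₀‖ = ‖(ε 0 ω - z₀) + (z₀ - x₀)‖ := by rw [sub_add_sub_cancel]
      _ ≤ ‖ε 0 ω - z₀‖ + ‖z₀ - x₀‖ := norm_add_le _ _
      _ ≤ _ := by linarith
  have h8 : Ch * ‖ε 0 ω - x₀‖ ^ α ≤ |Ch| * (‖z₀ - x₀‖ + 1) ^ α := by
    refine mul_le_mul (le_abs_self _) (Real.rpow_le_rpow (norm_nonneg _) h7 hα.le)
      (by positivity) (abs_nonneg _)
  have h9 : smallBall P ε z₀ u ≤ smallBall P ε (ε 0 ω) (2 * u) :=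
    smallBall_le_of_norm_sub_le (w := u) (by rwa [norm_sub_rev]) (by linarith)
  have h10 := (le_abs_self _).trans h6
  calc smallBall P ε z₀ u ≤ smallBall P ε (ε 0 ω) (2 * u) := h9
    _ ≤ smallBall P ε x₀ (2 * u) * M := by
        rw [hM]
        have := mul_le_mul_of_nonneg_right h8 hr.le
        linarith
    _ ≤ (C * smallBall P ε x₀ u) * M := by gcongr
    _ = _ := by ring

/-- The small ball conditions transfer the regularity of `P(‖ε_t - x₀‖ ≤ u)` to `φ`, and from there
to all centres in `S ∩ U(r)`, uniformly. -/
theorem SmallBallCondition.regularSmallBalls (hX : IsStationaryFAR P S Ψ X ε)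
    (hS : ∀ x ∈ S, ∃ r : ℝ, x ∈ lipBall D ν r) (hx₀ : x₀ ∈ S) (hα : 0 < α)
    (hball : SmallBallCondition P D S Ψ X ε x₀ α φ fε gε h) :
    RegularSmallBalls (smallBall P ε) S (lipBall D ν) φ fε α := by
  obtain ⟨A, hA⟩ := hball.annulus x₀ hx₀
  obtain ⟨C, hC, hdouble⟩ := eventually_doubling (smallBall_mono_radius x₀) hball.ref_pos hA
  obtain ⟨B, hB, hupper⟩ := hball.eventually_smallBall_le hX hx₀ hα
  obtain ⟨r₀, hr₀⟩ := hS x₀ hx₀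
  have hrem : ∀ r : ℝ, ∀ δ > 0, ∀ᶠ u in 𝓝[>] (0 : ℝ), ∀ y ∈ (S : Set (L2 ν)) ∩ lipBall D ν r,
      |smallBall P ε y u - fε y * φ u| ≤ δ * φ u := by
    intro r δ hδ
    filter_upwards [hball.remainder r δ hδ, eventually_pos_nhdsGT_zero] with u h1 h2 y hy
    rw [hball.decomposition y hy.1 u h2, add_sub_cancel_left]
    exact h1 y hy
  have hf_le : ∀ y ∈ S, fε y ≤ B * fε x₀ := by
    intro y hy
    obtain ⟨r, hr⟩ := hS y hy
    refine le_of_forall_pos_le_add fun δ hδ => ?_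
    have hδ' : 0 < δ / (B + 1) := by positivity
    obtain ⟨u, h1, h2, h3, h4⟩ := ((hrem r _ hδ').and ((hrem r₀ _ hδ').and
      (hupper.and eventually_pos_nhdsGT_zero))).exists
    have h5 := (abs_le.1 (h1 y ⟨hy, hr⟩)).1
    have h6 := (abs_le.1 (h2 x₀ ⟨hx₀, hr₀⟩)).2
    have h7 := h3 y
    have hφ := hball.phi_pos u h4
    have h8 : fε y * φ u ≤ (B * fε x₀ + δ) * φ u := by
      have h9 : B * smallBall P ε x₀ u ≤ B * (fε x₀ * φ u + δ / (B + 1) * φ u) := by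
        gcongr; linarith
      have h10 : (B + 1) * (δ / (B + 1)) = δ := by field_simp
      calc fε y * φ u ≤ B * (fε x₀ * φ u + δ / (B + 1) * φ u) + δ / (B + 1) * φ u := by linarith
        _ = (B * fε x₀ + (B + 1) * (δ / (B + 1))) * φ u := by ring
        _ = _ := by rw [h10]
    exact le_of_mul_le_mul_right h8 hφ
  -- If `fε x₀` vanished, then so would `fε` on `S` and hence `f_X`.
  have hf0 : 0 < fε x₀ := by
    refine (hball.f_nonneg x₀ hx₀).lt_of_ne fun h0 => ?_
    obtain ⟨c, hc, hcle⟩ := hball.fX_pos r₀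
    have h1 := hcle x₀ ⟨hx₀, hr₀⟩
    have h2 : fX P Ψ X fε x₀ = 0 := by
      refine integral_eq_zero_of_ae ?_
      filter_upwards [hX.ae_operator_mem 0] with ω hω
      have hmem : x₀ - Ψ (X 0 ω) ∈ S := S.sub_mem hx₀ hω
      have := hf_le _ hmem
      rw [← h0, mul_zero] at this
      exact le_antisymm this (hball.f_nonneg _ hmem)
    linarith
  have hp_le : ∀ᶠ u in 𝓝[>] (0 : ℝ), smallBall P ε x₀ u ≤ (fε x₀ + 1) * φ u := by
    filter_upwards [hrem r₀ 1 one_pos] with u hu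
    have := (abs_le.1 (hu x₀ ⟨hx₀, hr₀⟩)).2
    linarith
  have hp_ge : ∀ᶠ u in 𝓝[>] (0 : ℝ), φ u ≤ 2 / fε x₀ * smallBall P ε x₀ u := by
    filter_upwards [hrem r₀ _ (half_pos hf0)] with u hu
    have := (abs_le.1 (hu x₀ ⟨hx₀, hr₀⟩)).1
    rw [div_mul_eq_mul_div, le_div_iff₀ hf0]
    linarith
  set E : ℝ := 2 / fε x₀ * (C * (fε x₀ + 1)) with hE
  have hE0 : 0 < E := by positivity
  have hcomp : ∀ c ∈ Ioc (0 : ℝ) 2, ∀ᶠ u in 𝓝[>] (0 : ℝ), φ (c * u) ≤ E * φ u := by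
    intro c hc
    filter_upwards [(tendsto_const_mul_nhdsGT_zero hc.1).eventually hp_ge, hp_le, hdouble,
      eventually_pos_nhdsGT_zero] with u h1 h2 h3 h4
    have h5 : smallBall P ε x₀ (c * u) ≤ smallBall P ε x₀ (2 * u) :=
      smallBall_mono_radius x₀ (by nlinarith [hc.2])
    calc φ (c * u) ≤ 2 / fε x₀ * smallBall P ε x₀ (c * u) := h1
      _ ≤ 2 / fε x₀ * (C * ((fε x₀ + 1) * φ u)) := by
          gcongr
          exact h5.trans (h3.trans (by gcongr))
      _ = E * φ u := by rw [hE]; ring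
  refine ⟨hball.phi_pos, ⟨E, hE0, hcomp 2 ⟨two_pos, le_rfl⟩⟩,
    ⟨B * (fε x₀ + 1), by positivity, ?_⟩, ⟨B * fε x₀, by positivity, fun y hy =>
    ⟨hball.f_nonneg y hy, hf_le y hy⟩⟩, ?_, hrem, ?_⟩
  · filter_upwards [hupper, hp_le] with u h1 h2 y
    calc _ ≤ B * smallBall P ε x₀ u := h1 y
      _ ≤ B * ((fε x₀ + 1) * φ u) := by gcongr
      _ = _ := by ring
  · obtain ⟨Ch, hCh⟩ := hball.holder
    refine ⟨(|Ch| + 1) * (fε x₀ + 1), by positivity, ?_⟩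
    filter_upwards [hCh, hp_le, eventually_pos_nhdsGT_zero] with u h1 h2 h3 y₁ hy₁ y₂ hy₂
    have hr := hball.ref_pos u h3
    have h4 := h1 y₁ hy₁ y₂ hy₂
    rw [← sub_div, abs_div, abs_of_pos hr, div_le_iff₀ hr] at h4
    have h5 := (le_abs_self _).trans h4
    have hn : 0 ≤ ‖y₁ - y₂‖ ^ α := by positivity
    have h6 : Ch * ‖y₁ - y₂‖ ^ α * smallBall P ε x₀ u
        ≤ (|Ch| + 1) * ‖y₁ - y₂‖ ^ α * ((fε x₀ + 1) * φ u) := by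
      refine mul_le_mul ?_ h2 hr.le (by positivity)
      gcongr
      linarith [le_abs_self Ch]
    linarith
  · intro r δ hδ κ₀ hκ₀
    set Q : ℝ := B * |A| * (fε x₀ + 1) + 1 with hQ
    have hQ1 : 1 ≤ Q := by
      have : 0 ≤ B * |A| * (fε x₀ + 1) := by positivity
      linarith
    set κ : ℝ := min (min (1 / 4) κ₀) (δ / (2 * Q)) with hκ
    have hκ0 : 0 < κ := lt_min (lt_min (by norm_num) hκ₀) (by positivity)
    have hκ4 : κ ≤ 1 / 4 := (min_le_left _ _).trans (min_le_left _ _)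
    have hκQ : κ * Q ≤ δ / 2 := by
      calc κ * Q ≤ δ / (2 * Q) * Q := by gcongr; exact min_le_right _ _
        _ = δ / 2 := by field_simp
    set δ₁ : ℝ := δ / (4 * E * (B + 1)) with hδ₁
    have hδ₁0 : 0 < δ₁ := by positivity
    have hδE : 2 * δ₁ * E * (B + 1) = δ / 2 := by rw [hδ₁]; field_simp; norm_num
    have hplus : 0 < 1 + κ := by linarith
    have hminus : 0 < 1 - κ := by linarith
    refine ⟨κ, ⟨hκ0, by linarith⟩, (min_le_left _ _).trans (min_le_right _ _), ?_⟩
    filter_upwards [(tendsto_const_mul_nhdsGT_zero hplus).eventually (hrem r δ₁ hδ₁0),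
      (tendsto_const_mul_nhdsGT_zero hminus).eventually (hrem r δ₁ hδ₁0),
      (tendsto_const_mul_nhdsGT_zero hplus).eventually (hrem r₀ δ₁ hδ₁0),
      (tendsto_const_mul_nhdsGT_zero hminus).eventually (hrem r₀ δ₁ hδ₁0),
      hcomp (1 + κ) ⟨hplus, by linarith⟩, hcomp (1 - κ) ⟨hminus, by linarith⟩, hA, hp_le,
      eventually_pos_nhdsGT_zero] with u h1 h2 h3 h4 h5 h6 h7 h8 hu y hy
    have hr := hball.ref_pos u hu
    have hφ := hball.phi_pos u hu
    have h9 := h7 (κ * u) ⟨by positivity, by nlinarith⟩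
    have e1 : u + κ * u = (1 + κ) * u := by ring
    have e2 : u - κ * u = (1 - κ) * u := by ring
    have e3 : A * (κ * u) * u⁻¹ = A * κ := by field_simp
    rw [e1, e2, e3, ← div_eq_mul_inv, div_le_iff₀ hr] at h9
    have a1 := (abs_le.1 (h1 y hy)).2
    have a2 := (abs_le.1 (h2 y hy)).1
    have a3 := (abs_le.1 (h3 x₀ ⟨hx₀, hr₀⟩)).1
    have a4 := (abs_le.1 (h4 x₀ ⟨hx₀, hr₀⟩)).2
    have b1 : δ₁ * φ ((1 + κ) * u) + δ₁ * φ ((1 - κ) * u) ≤ 2 * δ₁ * E * φ u := by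
      have := mul_le_mul_of_nonneg_left h5 hδ₁0.le
      have := mul_le_mul_of_nonneg_left h6 hδ₁0.le
      linarith
    have b2 : A * κ * smallBall P ε x₀ u ≤ |A| * κ * ((fε x₀ + 1) * φ u) := by
      refine mul_le_mul ?_ h8 hr.le (by positivity)
      gcongr
      exact le_abs_self A
    have b3 : fε x₀ * (φ ((1 + κ) * u) - φ ((1 - κ) * u))
        ≤ |A| * κ * ((fε x₀ + 1) * φ u) + 2 * δ₁ * E * φ u := by linarith
    have b4 : fε y * (φ ((1 + κ) * u) - φ ((1 - κ) * u))
        ≤ B * (|A| * κ * ((fε x₀ + 1) * φ u) + 2 * δ₁ * E * φ u) := by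
      have hfy := hball.f_nonneg y hy.1
      have hratio : fε y / fε x₀ ≤ B := by rw [div_le_iff₀ hf0]; exact hf_le y hy.1
      calc fε y * (φ ((1 + κ) * u) - φ ((1 - κ) * u))
          = fε y / fε x₀ * (fε x₀ * (φ ((1 + κ) * u) - φ ((1 - κ) * u))) := by field_simp
        _ ≤ fε y / fε x₀ * (|A| * κ * ((fε x₀ + 1) * φ u) + 2 * δ₁ * E * φ u) := by
            gcongr
        _ ≤ _ := by gcongr
    calc smallBall P ε y ((1 + κ) * u) - smallBall P ε y ((1 - κ) * u)
        ≤ B * (|A| * κ * ((fε x₀ + 1) * φ u) + 2 * δ₁ * E * φ u) + 2 * δ₁ * E * φ u := by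
          linarith
      _ = (κ * (B * |A| * (fε x₀ + 1)) + 2 * δ₁ * E * (B + 1)) * φ u := by ring
      _ ≤ (κ * Q + δ / 2) * φ u := by
          rw [hδE]
          gcongr
          linarith
      _ ≤ δ * φ u := by gcongr; linarith

end SmallBalls

/-! ### Nets and marginal laws -/

/-- A set of points whose `u`-neighbourhoods all have mass at least `c` has a `2u`-net of at most
`1 / c` points, by maximality of a `2u`-separated subset. -/
theorem exists_finset_net {H : Type*} [NormedAddCommGroup H] [MeasurableSpace H] [BorelSpace H]
    (μ : Measure H) [IsProbabilityMeasure μ] {C : Set H} {u c : ℝ} (hc : 0 < c)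
    (hball : ∀ x ∈ C, c ≤ μ.real (Metric.closedBall x u)) :
    ∃ J : Finset H, (J : Set H) ⊆ C ∧ J.card * c ≤ 1 ∧ ∀ x ∈ C, ∃ z ∈ J, ‖x - z‖ ≤ 2 * u := by
  classical
  let Q : Finset H → Prop := fun J => (J : Set H) ⊆ C ∧
    (J : Set H).Pairwise fun x y => 2 * u < ‖x - y‖
  have hcard : ∀ J, Q J → J.card * c ≤ 1 := by
    intro J hJ
    have hdisj : (J : Set H).PairwiseDisjoint fun x => Metric.closedBall x u := by
      intro x hx y hy hxy
      refine Metric.closedBall_disjoint_closedBall ?_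
      have := hJ.2 hx hy hxy
      rw [dist_eq_norm]; linarith
    calc J.card * c = ∑ _x ∈ J, c := by rw [Finset.sum_const, nsmul_eq_mul]
      _ ≤ ∑ x ∈ J, μ.real (Metric.closedBall x u) := Finset.sum_le_sum fun x hx => hball x (hJ.1 hx)
      _ = μ.real (⋃ x ∈ J, Metric.closedBall x u) :=
          (measureReal_biUnion_finset hdisj fun _ _ =>
            Metric.isClosed_closedBall.measurableSet).symm
      _ ≤ 1 := measureReal_le_one
  let R : ℕ → Prop := fun k => ∃ J, Q J ∧ J.card = k
  have hR0 : R 0 := ⟨∅, ⟨by simp, by simp⟩, rfl⟩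
  have hRle : ∀ k, R k → k ≤ ⌊1 / c⌋₊ := by
    rintro k ⟨J, hJ, rfl⟩
    exact Nat.le_floor (by rw [le_div_iff₀ hc]; exact hcard J hJ)
  obtain ⟨J, hJ, hJk⟩ := Nat.findGreatest_spec (P := R) (Nat.zero_le ⌊1 / c⌋₊) hR0
  refine ⟨J, hJ.1, hcard J hJ, fun x hx => ?_⟩
  by_contra! hcon
  have hu : 0 ≤ u := by
    by_contra! hu
    have := hball x hx
    rw [Metric.closedBall_eq_empty.2 hu, measureReal_empty] at this
    linarith
  have hxJ : x ∉ J := fun h => by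
    have := hcon x h
    rw [sub_self, norm_zero] at this
    linarith
  have hQ : Q (insert x J) := by
    refine ⟨?_, ?_⟩
    · rw [Finset.coe_insert]; exact insert_subset hx hJ.1
    · rw [Finset.coe_insert]
      refine hJ.2.insert fun y hy _ => ⟨hcon y hy, ?_⟩
      rw [norm_sub_rev]
      exact hcon y hy
  have hRk : R (J.card + 1) := ⟨_, hQ, Finset.card_insert_of_notMem hxJ⟩
  have := Nat.le_findGreatest (P := R) (hRle _ hRk) hRk
  omega

section Marginals

variable {Ω : Type*} [MeasurableSpace Ω] {P : Measure Ω} [IsProbabilityMeasure P] {ν : Measure ℝ}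
  {ε X : ℤ → Ω → L2 ν} {S : Submodule ℝ (L2 ν)} {Ψ : L2 ν → L2 ν}

omit [IsProbabilityMeasure P] in
theorem IsStationaryFAR.isAutoregression [SecondCountableTopology (L2 ν)]
    (hX : IsStationaryFAR P S Ψ X ε)
    (hΨ : Measurable Ψ) : IsAutoregression P Ψ X ε :=
  ⟨hX.measurable_process, hX.measurable_innov, hΨ, hX.recursion, hX.innov_ident,
    hX.innov_indep_past⟩

omit [IsProbabilityMeasure P] in
theorem IsStationaryFAR.identDistrib (hX : IsStationaryFAR P S Ψ X ε) (t : ℤ) :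
    IdentDistrib (X t) (X 0) P P := by
  refine ⟨(hX.measurable_process t).aemeasurable, (hX.measurable_process 0).aemeasurable, ?_⟩
  have hst : (P.map fun ω (s : ℤ) => X (s + t) ω).map (fun x => x 0)
      = (P.map fun ω (s : ℤ) => X s ω).map (fun x => x 0) := by rw [hX.stationary t]
  rw [Measure.map_map (measurable_pi_apply 0)
      (measurable_pi_lambda _ fun s => hX.measurable_process (s + t)),
    Measure.map_map (measurable_pi_apply 0)
      (measurable_pi_lambda _ fun s => hX.measurable_process s)] at hst
  simpa [Function.comp_def] using hst

omit [IsProbabilityMeasure P] in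
theorem transitionProb_closedBall (z v : L2 ν) (u : ℝ) :
    transitionProb P Ψ ε (Metric.closedBall z u) v = smallBall P ε (z - Ψ v) u := by
  unfold transitionProb smallBall
  congr 1
  ext ω
  simp only [mem_ofPred_eq, Metric.mem_closedBall, dist_eq_norm]
  rw [show Ψ v + ε 0 ω - z = ε 0 ω - (z - Ψ v) by abel]

/-- The law of `X₁` is the mixture of the transition probabilities over the law of `X₀`. -/
theorem IsAutoregression.measureReal_mem [SecondCountableTopology (L2 ν)]
    (hA : IsAutoregression P Ψ X ε) {B : Set (L2 ν)}
    (hB : MeasurableSet B) :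
    P.real {ω | X 1 ω ∈ B} = ∫ ω, transitionProb P Ψ ε B (X 0 ω) ∂P := by
  have hind : IndepFun (X 0) (ε 1) P :=
    (indep_of_indep_of_le_right (hA.innov_indep_past 1)
      (measurable_strictPast X zero_lt_one).comap_le).symm
  have hX0 := hA.measurable_process 0
  have hε := hA.measurable_innov 1
  have hmap := (indepFun_iff_map_prod_eq_prod_map_map hX0.aemeasurable hε.aemeasurable).1 hind
  have hF : MeasurableSet {q : L2 ν × L2 ν | Ψ q.1 + q.2 ∈ B} :=
    ((hA.measurable_operator.comp measurable_fst).add measurable_snd) hB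
  have := Measure.isProbabilityMeasure_map (μ := P) hε.aemeasurable
  have := Measure.isProbabilityMeasure_map (μ := P) hX0.aemeasurable
  have h1 : P {ω | X 1 ω ∈ B} = ∫⁻ ω, P {ω' | Ψ (X 0 ω) + ε 0 ω' ∈ B} ∂P := by
    calc P {ω | X 1 ω ∈ B} = P {ω | Ψ (X 0 ω) + ε 1 ω ∈ B} := by
          refine measure_congr ?_
          filter_upwards [hA.recursion 1] with ω hω
          rw [sub_self] at hω
          refine propext ?_
          change X 1 ω ∈ B ↔ Ψ (X 0 ω) + ε 1 ω ∈ B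
          rw [hω]
      _ = (P.map fun ω => (X 0 ω, ε 1 ω)) {q : L2 ν × L2 ν | Ψ q.1 + q.2 ∈ B} := by
          rw [Measure.map_apply (hX0.prodMk hε) hF]; rfl
      _ = ∫⁻ v, (P.map (ε 1))
            (Prod.mk v ⁻¹' {q : L2 ν × L2 ν | Ψ q.1 + q.2 ∈ B}) ∂(P.map (X 0)) := by
          rw [hmap, Measure.prod_apply hF]
      _ = ∫⁻ ω, (P.map (ε 1)) (Prod.mk (X 0 ω) ⁻¹' {q : L2 ν × L2 ν | Ψ q.1 + q.2 ∈ B}) ∂P := by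
          rw [lintegral_map (measurable_measure_prodMk_left hF) hX0]
      _ = _ := by
          refine lintegral_congr fun ω => ?_
          rw [(hA.innov_ident 1).map_eq,
            Measure.map_apply (hA.measurable_innov 0) (measurable_prodMk_left hF)]
          rfl
  have h2 : ∀ ω, P {ω' | Ψ (X 0 ω) + ε 0 ω' ∈ B}
      = ENNReal.ofReal (transitionProb P Ψ ε B (X 0 ω)) := fun ω => by simp [transitionProb]
  rw [Measure.real, h1]
  simp_rw [h2]
  rw [integral_eq_lintegral_of_nonneg_ae (f := fun ω => transitionProb P Ψ ε B (X 0 ω))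
    (Eventually.of_forall fun _ => measureReal_nonneg)
    ((hA.measurable_transitionProb hB).comp hX0).aestronglyMeasurable]

/-- Large values of a stationary process are rare, and so is a large fraction of them. -/
theorem IsStationaryFAR.exists_norm_bound (hX : IsStationaryFAR P S Ψ X ε) {δ η : ℝ} (hδ : 0 < δ)
    (hη : 0 < η) :
    ∃ M : ℝ, P.real {ω | M < ‖X 0 ω‖} ≤ δ ∧ ∀ n : ℕ, 0 < n →
      P {ω | δ * n < ∑ t ∈ Finset.Icc 1 n,
        {x : L2 ν | M < ‖x‖}.indicator (fun _ => (1 : ℝ)) (X ((t : ℤ) - 1) ω)}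
        ≤ ENNReal.ofReal η := by
  have hmeas : ∀ M : ℝ, MeasurableSet {x : L2 ν | M < ‖x‖} := fun M =>
    measurableSet_lt measurable_const measurable_norm
  have hset : ∀ M : ℝ, MeasurableSet {ω | M < ‖X 0 ω‖} := fun M =>
    hX.measurable_process 0 (hmeas M)
  have hlim : Tendsto (fun k : ℕ => P {ω | (k : ℝ) < ‖X 0 ω‖}) atTop (𝓝 0) := by
    have hanti : Antitone fun k : ℕ => {ω | (k : ℝ) < ‖X 0 ω‖} := by
      intro i j hij ω hω
      have hω' : (j : ℝ) < ‖X 0 ω‖ := hω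
      exact lt_of_le_of_lt (Nat.cast_le.2 hij) hω'
    have hempty : ⋂ k : ℕ, {ω | (k : ℝ) < ‖X 0 ω‖} = ∅ := by
      rw [eq_empty_iff_forall_notMem]
      intro ω hω
      obtain ⟨k, hk⟩ := exists_nat_ge ‖X 0 ω‖
      have : (k : ℝ) < ‖X 0 ω‖ := mem_iInter.1 hω k
      linarith
    have := tendsto_measure_iInter_atTop (μ := P)
      (fun k : ℕ => (hset k).nullMeasurableSet) hanti
      ⟨0, measure_ne_top _ _⟩
    rwa [hempty, measure_empty] at this
  have hpos : (0 : ℝ≥0∞) < ENNReal.ofReal (min δ (δ * η)) := by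
    rw [ENNReal.ofReal_pos]; positivity
  obtain ⟨k, hk⟩ := (hlim.eventually (eventually_lt_nhds hpos)).exists
  have hk' : P.real {ω | (k : ℝ) < ‖X 0 ω‖} ≤ min δ (δ * η) :=
    ENNReal.toReal_le_of_le_ofReal (by positivity) hk.le
  refine ⟨k, hk'.trans (min_le_left _ _), fun n hn => ?_⟩
  have hn' : (0 : ℝ) < n := by exact_mod_cast hn
  set I : L2 ν → ℝ≥0∞ := {x : L2 ν | (k : ℝ) < ‖x‖}.indicator fun _ => 1 with hI
  have hIm : Measurable I := measurable_const.indicator (hmeas k)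
  have hint : ∀ t : ℤ, ∫⁻ ω, I (X t ω) ∂P = P {ω | (k : ℝ) < ‖X 0 ω‖} := by
    intro t
    have hid : ∫⁻ ω, I (X t ω) ∂P = ∫⁻ ω, I (X 0 ω) ∂P :=
      ((hX.identDistrib t).comp hIm).lintegral_eq
    rw [hid]
    have : (fun ω => I (X 0 ω)) = {ω | (k : ℝ) < ‖X 0 ω‖}.indicator fun _ => 1 := by
      funext ω; simp [hI, indicator]
    rw [this, lintegral_indicator_const (hset k), one_mul]
  have hsub : {ω | δ * n < ∑ t ∈ Finset.Icc 1 n,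
        {x : L2 ν | (k : ℝ) < ‖x‖}.indicator (fun _ => (1 : ℝ)) (X ((t : ℤ) - 1) ω)}
      ⊆ {ω | ENNReal.ofReal (δ * n) ≤ ∑ t ∈ Finset.Icc 1 n, I (X ((t : ℤ) - 1) ω)} := by
    intro ω hω
    have hω' : δ * n < ∑ t ∈ Finset.Icc 1 n,
        {x : L2 ν | (k : ℝ) < ‖x‖}.indicator (fun _ => (1 : ℝ)) (X ((t : ℤ) - 1) ω) := hω
    change ENNReal.ofReal (δ * n) ≤ ∑ t ∈ Finset.Icc 1 n, I (X ((t : ℤ) - 1) ω)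
    refine (ENNReal.ofReal_le_ofReal hω'.le).trans (le_of_eq ?_)
    rw [ENNReal.ofReal_sum_of_nonneg fun _ _ => indicator_nonneg (fun _ _ => zero_le_one) _]
    refine Finset.sum_congr rfl fun t _ => ?_
    by_cases h : (k : ℝ) < ‖X ((t : ℤ) - 1) ω‖ <;> simp [hI, indicator, h]
  have hIX : ∀ t ∈ Finset.Icc 1 n, Measurable fun ω => I (X ((t : ℤ) - 1) ω) := fun t _ =>
    hIm.comp (hX.measurable_process ((t : ℤ) - 1))
  have hmarkov := mul_meas_ge_le_lintegral (μ := P)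
    (Finset.measurable_sum (Finset.Icc 1 n) hIX) (ENNReal.ofReal (δ * n))
  have h0 : ENNReal.ofReal (δ * n) ≠ 0 := by
    rw [Ne, ENNReal.ofReal_eq_zero, not_le]; positivity
  have hsum : ∫⁻ ω, ∑ t ∈ Finset.Icc 1 n, I (X ((t : ℤ) - 1) ω) ∂P
      ≤ ENNReal.ofReal (δ * n) * ENNReal.ofReal η := by
    rw [lintegral_finsetSum _ hIX]
    simp only [hint, Finset.sum_const, Nat.card_Icc, add_tsub_cancel_right, nsmul_eq_mul]
    rw [← ENNReal.ofReal_mul (by positivity)]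
    calc (n : ℝ≥0∞) * P {ω | (k : ℝ) < ‖X 0 ω‖} ≤ (n : ℝ≥0∞) * ENNReal.ofReal (δ * η) := by
          gcongr
          exact hk.le.trans (ENNReal.ofReal_le_ofReal (min_le_right _ _))
      _ = ENNReal.ofReal (δ * n * η) := by
          rw [← ENNReal.ofReal_natCast, ← ENNReal.ofReal_mul (by positivity)]
          ring_nf
  refine (measure_mono hsub).trans ?_
  exact (ENNReal.mul_le_mul_iff_right h0 ENNReal.ofReal_ne_top).1 (hmarkov.trans hsum)

end Marginals

/-! ### Lower bounds for visits to small balls -/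

section LowerBounds

variable {Ω : Type*} [MeasurableSpace Ω] {P : Measure Ω} [IsProbabilityMeasure P] {ν : Measure ℝ}
  {ε X : ℤ → Ω → L2 ν} {S : Submodule ℝ (L2 ν)} {Ψ : L2 ν → L2 ν} {D : Set ℝ} {α : ℝ}
  {φ : ℝ → ℝ} {fε : L2 ν → ℝ} {gε : ℝ → L2 ν → ℝ} {h : ℕ → ℝ} {x₀ : L2 ν}

/-- The recentred points `x - Ψ(v)` stay in one of the sets `U(r')` when `x` ranges over `S ∩ U(r)`
and `v` over a bounded subset of `S`. -/
def RecentringCondition (D : Set ℝ) {ν : Measure ℝ} (S : Submodule ℝ (L2 ν))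
    (Ψ : L2 ν → L2 ν) : Prop :=
  ∀ r M : ℝ, ∃ r' : ℝ, ∀ x ∈ (S : Set (L2 ν)) ∩ lipBall D ν r, ∀ v ∈ S, ‖v‖ ≤ M →
    x - Ψ v ∈ lipBall D ν r'

omit [IsProbabilityMeasure P] in
/-- The remainder in the small ball decomposition is only controlled on the sets `U(r')`, which
contain `x - Ψ v` for bounded `v`; for the other `v` the bound is made trivial. -/
theorem RegularSmallBalls.eventually_le_smallBall
    (hreg : RegularSmallBalls (smallBall P ε) S (lipBall D ν) φ fε α)
    (hU : RecentringCondition D S Ψ) {B : ℝ} (hB : ∀ y ∈ S, fε y ∈ Icc 0 B) (r M : ℝ) {δ : ℝ}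
    (hδ : 0 < δ) :
    ∀ᶠ u in 𝓝[>] (0 : ℝ), ∀ x ∈ (S : Set (L2 ν)) ∩ lipBall D ν r, ∀ v ∈ S, Ψ v ∈ S →
      (fε (x - Ψ v) - B * {y : L2 ν | M < ‖y‖}.indicator (fun _ => (1 : ℝ)) v - δ) * φ u
        ≤ smallBall P ε (x - Ψ v) u := by
  obtain ⟨r', hr'⟩ := hU r M
  filter_upwards [hreg.remainder r' δ hδ, eventually_pos_nhdsGT_zero] with u h1 h2 x hx v hv hΨv
  have hmem : x - Ψ v ∈ S := S.sub_mem hx.1 hΨv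
  have hφ := hreg.phi_pos u h2
  by_cases hM : M < ‖v‖
  · have hf := (hB _ hmem).2
    have hle :
        (fε (x - Ψ v) - B * {y : L2 ν | M < ‖y‖}.indicator (fun _ => (1 : ℝ)) v - δ) ≤ 0 := by
      rw [indicator_of_mem (show v ∈ {y : L2 ν | M < ‖y‖} from hM)]
      linarith
    exact (mul_nonpos_of_nonpos_of_nonneg hle hφ.le).trans (smallBall_nonneg _ _)
  · have h3 := (abs_le.1 (h1 _ ⟨hmem, hr' x hx v hv (not_lt.1 hM)⟩)).1
    rw [indicator_of_notMem (show v ∉ {y : L2 ν | M < ‖y‖} from hM)]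
    linarith

omit [IsProbabilityMeasure P] in
theorem RegularSmallBalls.eventually_le_pow_mul
    (hreg : RegularSmallBalls (smallBall P ε) S (lipBall D ν) φ fε α) :
    ∃ E > 0, ∀ k : ℕ, ∀ᶠ u in 𝓝[>] (0 : ℝ), φ u ≤ E ^ k * φ ((1 / 2) ^ k * u) := by
  obtain ⟨E, hE, hdouble⟩ := hreg.doubling
  refine ⟨E, hE, fun k => ?_⟩
  induction k with
  | zero => simp
  | succ k ih =>
    have hpos : (0 : ℝ) < (1 / 2) ^ (k + 1) := by positivity
    filter_upwards [ih, (tendsto_const_mul_nhdsGT_zero hpos).eventually hdouble] with u h1 h2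
    have h3 : 2 * ((1 / 2 : ℝ) ^ (k + 1) * u) = (1 / 2) ^ k * u := by rw [pow_succ]; ring
    rw [h3] at h2
    calc φ u ≤ E ^ k * φ ((1 / 2) ^ k * u) := h1
      _ ≤ E ^ k * (E * φ ((1 / 2) ^ (k + 1) * u)) := by gcongr
      _ = _ := by ring

variable [SecondCountableTopology (L2 ν)]

theorem IsStationaryFAR.measurable_smallBall (hX : IsStationaryFAR P S Ψ X ε) (hΨ : Measurable Ψ)
    (z : L2 ν) (u : ℝ) (t : ℤ) : Measurable fun ω => smallBall P ε (z - Ψ (X t ω)) u := by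
  simp_rw [← transitionProb_closedBall]
  exact ((hX.isAutoregression hΨ).measurable_transitionProb
    Metric.isClosed_closedBall.measurableSet).comp (hX.measurable_process t)

/-- Along the process, `fε` is an almost sure limit of normalised small ball probabilities. -/
theorem IsStationaryFAR.aemeasurable_density (hX : IsStationaryFAR P S Ψ X ε) (hΨ : Measurable Ψ)
    (hS : ∀ x ∈ S, ∃ r : ℝ, x ∈ lipBall D ν r)
    (hreg : RegularSmallBalls (smallBall P ε) S (lipBall D ν) φ fε α) {z : L2 ν} (hz : z ∈ S)
    (t : ℤ) : AEMeasurable (fun ω => fε (z - Ψ (X t ω))) P := by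
  refine aemeasurable_of_tendsto_metrizable_ae (𝓝[>] (0 : ℝ))
    (f := fun u ω => smallBall P ε (z - Ψ (X t ω)) u / φ u)
    (fun u => ((hX.measurable_smallBall hΨ z u t).div_const _).aemeasurable) ?_
  filter_upwards [hX.ae_operator_mem t] with ω hω
  have hmem : z - Ψ (X t ω) ∈ S := S.sub_mem hz hω
  obtain ⟨r, hr⟩ := hS _ hmem
  rw [Metric.tendsto_nhds]
  intro δ hδ
  filter_upwards [hreg.remainder r (δ / 2) (half_pos hδ), eventually_pos_nhdsGT_zero] with u h1 h2
  have hφ := hreg.phi_pos u h2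
  have h3 := h1 _ ⟨hmem, hr⟩
  rw [Real.dist_eq, div_sub' hφ.ne', abs_div, abs_of_pos hφ, div_lt_iff₀ hφ, mul_comm (φ u)]
  exact h3.trans_lt (by gcongr; linarith)

/-- The stationary law charges every ball around a point of `S ∩ U(r)` on the scale `φ`. -/
theorem IsStationaryFAR.exists_le_measureReal_closedBall (hX : IsStationaryFAR P S Ψ X ε)
    (hΨ : Measurable Ψ)
    (hreg : RegularSmallBalls (smallBall P ε) S (lipBall D ν) φ fε α)
    (hU : RecentringCondition D S Ψ) {r c : ℝ} (hc : 0 < c)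
    (hfX : ∀ x ∈ (S : Set (L2 ν)) ∩ lipBall D ν r, c ≤ fX P Ψ X fε x) :
    ∀ᶠ u in 𝓝[>] (0 : ℝ), ∀ x ∈ (S : Set (L2 ν)) ∩ lipBall D ν r,
      c / 2 * φ u ≤ (P.map (X 0)).real (Metric.closedBall x u) := by
  obtain ⟨B, hB, hfB⟩ := hreg.density_bounds
  obtain ⟨M, hM, -⟩ := hX.exists_norm_bound (by positivity : 0 < c / (4 * B)) one_pos
  have hA := hX.isAutoregression hΨ
  have hset : MeasurableSet {y : L2 ν | M < ‖y‖} :=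
    measurableSet_lt measurable_const measurable_norm
  filter_upwards [hreg.eventually_le_smallBall hU hfB r M (by positivity : 0 < c / 4),
    eventually_pos_nhdsGT_zero] with u h1 h2 x hx
  have hφ := hreg.phi_pos u h2
  have hfX' := hfX x hx
  -- A nonzero Bochner integral is that of an integrable function.
  have hfint : Integrable (fun ω => fε (x - Ψ (X 0 ω))) P := by
    by_contra hcon
    rw [fX, integral_undef hcon] at hfX'
    linarith
  have hball : MeasurableSet (Metric.closedBall x u) := Metric.isClosed_closedBall.measurableSet
  set I : L2 ν → ℝ := {y : L2 ν | M < ‖y‖}.indicator fun _ => (1 : ℝ) with hI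
  have hIint : Integrable (fun ω => I (X 0 ω)) P := by
    refine Integrable.of_bound
      ((measurable_const.indicator hset).comp (hX.measurable_process 0)).aestronglyMeasurable 1
      (Eventually.of_forall fun ω => ?_)
    by_cases h : M < ‖X 0 ω‖ <;> simp [hI, h]
  have hIval : ∫ ω, I (X 0 ω) ∂P = P.real {ω | M < ‖X 0 ω‖} := by
    have hset' : MeasurableSet {ω | M < ‖X 0 ω‖} := hX.measurable_process 0 hset
    exact integral_indicator_one hset'
  have hpint : Integrable (fun ω => smallBall P ε (x - Ψ (X 0 ω)) u) P := by
    refine Integrable.of_bound (hX.measurable_smallBall hΨ x u 0).aestronglyMeasurable 1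
      (Eventually.of_forall fun ω => ?_)
    rw [Real.norm_of_nonneg (smallBall_nonneg _ _)]
    exact measureReal_le_one
  have hmono : ∫ ω, (fε (x - Ψ (X 0 ω)) - B * I (X 0 ω) - c / 4) * φ u ∂P
      ≤ ∫ ω, smallBall P ε (x - Ψ (X 0 ω)) u ∂P := by
    refine integral_mono_ae (((hfint.sub (hIint.const_mul B)).sub
      (integrable_const _)).mul_const _) hpint ?_
    filter_upwards [hX.ae_operator_mem 0] with ω hω
    exact h1 x hx _ (hX.process_mem 0 ω) hω
  rw [integral_mul_const, integral_sub (f := fun ω => fε (x - Ψ (X 0 ω)) - B * I (X 0 ω))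
    (hfint.sub (hIint.const_mul B)) (integrable_const _),
    integral_sub hfint (hIint.const_mul B), integral_const_mul, hIval, integral_const,
    probReal_univ, one_smul] at hmono
  have hBM : B * P.real {ω | M < ‖X 0 ω‖} ≤ c / 4 := by
    calc _ ≤ B * (c / (4 * B)) := by gcongr
      _ = c / 4 := by field_simp
  have hP : (P.map (X 0)).real (Metric.closedBall x u)
      = ∫ ω, smallBall P ε (x - Ψ (X 0 ω)) u ∂P := by
    rw [← (hX.identDistrib 1).map_eq, map_measureReal_apply (hX.measurable_process 1) hball]
    simp_rw [← transitionProb_closedBall]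
    exact hA.measureReal_mem hball
  rw [hP]
  refine le_trans ?_ hmono
  refine mul_le_mul_of_nonneg_right ?_ hφ.le
  change c ≤ ∫ ω, fε (x - Ψ (X 0 ω)) ∂P at hfX'
  linarith

/-- At every scale `κ u` the set `S ∩ U(r)` has a net of size `O(1 / φ(u))`. -/
theorem IsStationaryFAR.exists_net (hX : IsStationaryFAR P S Ψ X ε) (hΨ : Measurable Ψ)
    (hreg : RegularSmallBalls (smallBall P ε) S (lipBall D ν) φ fε α)
    (hU : RecentringCondition D S Ψ) {r c : ℝ} (hc : 0 < c)
    (hfX : ∀ x ∈ (S : Set (L2 ν)) ∩ lipBall D ν r, c ≤ fX P Ψ X fε x) {κ : ℝ} (hκ : 0 < κ) :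
    ∃ A : ℝ, ∀ᶠ u in 𝓝[>] (0 : ℝ), ∃ J : Finset (L2 ν),
      (J : Set (L2 ν)) ⊆ (S : Set (L2 ν)) ∩ lipBall D ν r ∧ J.card * φ u ≤ A ∧
      ∀ x ∈ (S : Set (L2 ν)) ∩ lipBall D ν r, ∃ z ∈ J, ‖x - z‖ ≤ κ * u := by
  obtain ⟨E, hE, hpow⟩ := hreg.eventually_le_pow_mul
  obtain ⟨k, hk⟩ := exists_pow_lt_of_lt_one (half_pos hκ) (by norm_num : (1 / 2 : ℝ) < 1)
  have hpos : (0 : ℝ) < (1 / 2) ^ k := by positivity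
  have hP : IsProbabilityMeasure (P.map (X 0)) :=
    Measure.isProbabilityMeasure_map (hX.measurable_process 0).aemeasurable
  refine ⟨E ^ k * (2 / c), ?_⟩
  filter_upwards [hpow k, (tendsto_const_mul_nhdsGT_zero hpos).eventually
    (hX.exists_le_measureReal_closedBall hΨ hreg hU hc hfX), eventually_pos_nhdsGT_zero]
    with u h1 h2 hu
  have hφ := hreg.phi_pos ((1 / 2) ^ k * u) (by positivity)
  obtain ⟨J, hJ, hcard, hnet⟩ := exists_finset_net (P.map (X 0)) (by positivity) h2
  refine ⟨J, hJ, ?_, fun x hx => ?_⟩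
  · calc J.card * φ u ≤ J.card * (E ^ k * φ ((1 / 2) ^ k * u)) := by gcongr
      _ = E ^ k * (2 / c) * (J.card * (c / 2 * φ ((1 / 2) ^ k * u))) := by field_simp
      _ ≤ E ^ k * (2 / c) * 1 := by gcongr
      _ = _ := mul_one _
  · obtain ⟨z, hz, hxz⟩ := hnet x hx
    exact ⟨z, hz, hxz.trans (by nlinarith)⟩

omit [SecondCountableTopology (L2 ν)] in
/-- The ergodic condition at a single point, as convergence in probability. -/
theorem SmallBallCondition.tendsto_measure_density_average
    (hball : SmallBallCondition P D S Ψ X ε x₀ α φ fε gε h) (hh : ∀ n, 0 < h n)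
    {r c : ℝ} {z : L2 ν}
    (hmeas : ∀ t : ℤ, AEMeasurable (fun ω => fε (z - Ψ (X t ω))) P)
    (hz : z ∈ (S : Set (L2 ν)) ∩ lipBall D ν r) (hc : 0 < c) (hcz : c ≤ fX P Ψ X fε z) :
    Tendsto (fun n : ℕ => P {ω | ∑ t ∈ Finset.Icc 1 n, fε (z - Ψ (X ((t : ℤ) - 1) ω))
      < n * (c / 2)}) atTop (𝓝 0) := by
  have hconv : TendstoInMeasure P
      (fun (n : ℕ) ω => (n : ℝ)⁻¹ * ∑ t ∈ Finset.Icc 1 n, fε (z - Ψ (X ((t : ℤ) - 1) ω)))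
      atTop (fun _ => fX P Ψ X fε z) := by
    refine tendstoInMeasure_of_tendsto_ae (fun n => ?_) ?_
    · have hsum : AEMeasurable
          (fun ω => ∑ t ∈ Finset.Icc 1 n, fε (z - Ψ (X ((t : ℤ) - 1) ω))) P :=
        Finset.aemeasurable_fun_sum _ fun t _ => hmeas ((t : ℤ) - 1)
      exact (hsum.const_mul _).aestronglyMeasurable
    · filter_upwards [hball.ergodic r] with ω hω
      rw [Metric.tendsto_nhds]
      intro δ hδ
      filter_upwards [hω (δ / 2) (half_pos hδ)] with n hn
      have h1 := hn z hz
      have h2 : 0 ≤ (n : ℝ)⁻¹ * ∑ t ∈ Finset.Icc 1 n, |gε (h n) (z - Ψ (X ((t : ℤ) - 1) ω))|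
          * (φ (h n))⁻¹ := by
        have := hball.phi_pos (h n) (hh n)
        positivity
      rw [Real.dist_eq]
      linarith
  have h1 := tendstoInMeasure_iff_norm.1 hconv (c / 2) (half_pos hc)
  refine tendsto_of_tendsto_of_tendsto_of_le_of_le' tendsto_const_nhds h1
    (Eventually.of_forall fun _ => zero_le) ?_
  filter_upwards [eventually_gt_atTop 0] with n hn
  refine measure_mono fun ω hω => ?_
  have hn' : (0 : ℝ) < n := by exact_mod_cast hn
  have hω' : ∑ t ∈ Finset.Icc 1 n, fε (z - Ψ (X ((t : ℤ) - 1) ω)) < n * (c / 2) := hω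
  have h2 : (n : ℝ)⁻¹ * ∑ t ∈ Finset.Icc 1 n, fε (z - Ψ (X ((t : ℤ) - 1) ω)) < c / 2 := by
    rwa [inv_mul_lt_iff₀ hn']
  change c / 2 ≤ ‖_ - _‖
  rw [Real.norm_eq_abs, abs_sub_comm]
  exact le_trans (by linarith) (le_abs_self _)

/-- With high probability the conditional probabilities of visits to a ball of radius `u_n` add up
to at least a multiple of `n φ(u_n)`, uniformly over its centre. The law of large numbers is used
on a fixed finite net only; the Hölder condition does the rest. -/
theorem IsStationaryFAR.eventually_le_sum_smallBall (hX : IsStationaryFAR P S Ψ X ε)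
    (hΨ : Measurable Ψ) (hα : 0 < α) (hS : ∀ x ∈ S, ∃ r : ℝ, x ∈ lipBall D ν r)
    (hball : SmallBallCondition P D S Ψ X ε x₀ α φ fε gε h) (hh : ∀ n, 0 < h n)
    (hreg : RegularSmallBalls (smallBall P ε) S (lipBall D ν) φ fε α)
    (hU : RecentringCondition D S Ψ) {r c : ℝ} (hc : 0 < c)
    (hfX : ∀ x ∈ (S : Set (L2 ν)) ∩ lipBall D ν r, c ≤ fX P Ψ X fε x) {u : ℕ → ℝ}
    (hu : Tendsto u atTop (𝓝[>] 0)) {η : ℝ} (hη : 0 < η) :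
    ∀ᶠ n : ℕ in atTop, P {ω | ¬ ∀ x ∈ (S : Set (L2 ν)) ∩ lipBall D ν r,
      c / 8 * (n * φ (u n)) ≤
        ∑ t ∈ Finset.Icc 1 n, smallBall P ε (x - Ψ (X ((t : ℤ) - 1) ω)) (u n)}
      ≤ ENNReal.ofReal η := by
  obtain ⟨B, hB, hfB⟩ := hreg.density_bounds
  obtain ⟨Ch, hCh, hholder⟩ := hreg.holder
  set ρ : ℝ := (c / (8 * Ch)) ^ (1 / α) with hρ
  have hρ0 : 0 < ρ := by positivity
  have hρα : Ch * ρ ^ α = c / 8 := by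
    rw [hρ, ← Real.rpow_mul (by positivity), one_div_mul_cancel hα.ne', Real.rpow_one]
    field_simp
  obtain ⟨A, hnet⟩ := hX.exists_net hΨ hreg hU hc hfX one_pos
  obtain ⟨v, ⟨J, hJ, -, hJnet⟩, hvρ⟩ := (hnet.and (eventually_lt_nhdsGT_zero hρ0)).exists
  obtain ⟨M, -, hM⟩ := hX.exists_norm_bound (by positivity : 0 < c / (8 * B)) (half_pos hη)
  set I : L2 ν → ℝ := {y : L2 ν | M < ‖y‖}.indicator fun _ => (1 : ℝ) with hI
  have hbad : Tendsto (fun n : ℕ => ∑ z ∈ J, P {ω | ∑ t ∈ Finset.Icc 1 n,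
      fε (z - Ψ (X ((t : ℤ) - 1) ω)) < n * (c / 2)}) atTop (𝓝 (∑ _z ∈ J, 0)) :=
    tendsto_finsetSum _ fun z hz => hball.tendsto_measure_density_average hh
      (hX.aemeasurable_density hΨ hS hreg (hJ hz).1) (hJ hz) hc (hfX z (hJ hz))
  rw [Finset.sum_const_zero] at hbad
  have hη2 : (0 : ℝ≥0∞) < ENNReal.ofReal (η / 2) := by rw [ENNReal.ofReal_pos]; positivity
  have hae : ∀ᵐ ω ∂P, ∀ t : ℤ, Ψ (X t ω) ∈ S := ae_all_iff.2 hX.ae_operator_mem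
  filter_upwards [hbad.eventually (eventually_lt_nhds hη2), hu.eventually hholder,
    hu.eventually (hreg.eventually_le_smallBall hU hfB r M (by positivity : 0 < c / 8)),
    hu.eventually eventually_pos_nhdsGT_zero, eventually_gt_atTop 0] with n h1 h2 h3 h4 hn
  have hφ := hreg.phi_pos _ h4
  calc P {ω | ¬ ∀ x ∈ (S : Set (L2 ν)) ∩ lipBall D ν r, c / 8 * (n * φ (u n)) ≤
        ∑ t ∈ Finset.Icc 1 n, smallBall P ε (x - Ψ (X ((t : ℤ) - 1) ω)) (u n)}
      ≤ P ({ω | c / (8 * B) * n < ∑ t ∈ Finset.Icc 1 n, I (X ((t : ℤ) - 1) ω)} ∪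
          ⋃ z ∈ J, {ω | ∑ t ∈ Finset.Icc 1 n, fε (z - Ψ (X ((t : ℤ) - 1) ω)) < n * (c / 2)}) := by
        refine measure_mono_ae ?_
        filter_upwards [hae] with ω hω hbadω
        by_contra hcon
        have hcon' : ω ∉ ({ω | c / (8 * B) * n < ∑ t ∈ Finset.Icc 1 n, I (X ((t : ℤ) - 1) ω)} ∪
          ⋃ z ∈ J, {ω | ∑ t ∈ Finset.Icc 1 n,
            fε (z - Ψ (X ((t : ℤ) - 1) ω)) < n * (c / 2)} : Set Ω) := hcon
        simp only [mem_union, mem_iUnion, mem_ofPred_eq, not_or, not_exists, not_lt] at hcon'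
        refine hbadω fun x hx => ?_
        obtain ⟨z, hz, hxz⟩ := hJnet x hx
        have hzρ : Ch * ‖z - x‖ ^ α ≤ c / 8 := by
          rw [← hρα, norm_sub_rev]
          gcongr
          linarith
        have hterm : ∀ t : ℕ, (fε (z - Ψ (X ((t : ℤ) - 1) ω)) - B * I (X ((t : ℤ) - 1) ω)
            - c / 4) * φ (u n) ≤ smallBall P ε (x - Ψ (X ((t : ℤ) - 1) ω)) (u n) := by
          intro t
          have g1 := h2 (z - Ψ (X ((t : ℤ) - 1) ω)) (S.sub_mem (hJ hz).1 (hω _))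
            (x - Ψ (X ((t : ℤ) - 1) ω)) (S.sub_mem hx.1 (hω _))
          rw [sub_sub_sub_cancel_right] at g1
          have g2 := h3 z (hJ hz) _ (hX.process_mem ((t : ℤ) - 1) ω) (hω _)
          have g3 := mul_le_mul_of_nonneg_right hzρ hφ.le
          change (fε (z - Ψ (X ((t : ℤ) - 1) ω)) - B * I (X ((t : ℤ) - 1) ω) - c / 8) * φ (u n)
            ≤ _ at g2
          linarith
        refine le_trans ?_ (Finset.sum_le_sum fun t _ => hterm t)
        rw [← Finset.sum_mul, Finset.sum_sub_distrib, Finset.sum_sub_distrib, ← Finset.mul_sum,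
          Finset.sum_const, Nat.card_Icc, add_tsub_cancel_right, nsmul_eq_mul, ← mul_assoc]
        refine mul_le_mul_of_nonneg_right ?_ hφ.le
        have g4 := hcon'.2 z hz
        have g5 : B * ∑ t ∈ Finset.Icc 1 n, I (X ((t : ℤ) - 1) ω) ≤ c / 8 * n := by
          calc _ ≤ B * (c / (8 * B) * n) := by gcongr; exact hcon'.1
            _ = c / 8 * n := by field_simp
        linarith
    _ ≤ P {ω | c / (8 * B) * n < ∑ t ∈ Finset.Icc 1 n, I (X ((t : ℤ) - 1) ω)} +
          ∑ z ∈ J, P {ω | ∑ t ∈ Finset.Icc 1 n, fε (z - Ψ (X ((t : ℤ) - 1) ω)) < n * (c / 2)} :=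
        (measure_union_le _ _).trans (by gcongr; exact measure_biUnion_finset_le _ _)
    _ ≤ ENNReal.ofReal (η / 2) + ENNReal.ofReal (η / 2) := add_le_add (hM n hn) h1.le
    _ = ENNReal.ofReal η := by
        rw [← ENNReal.ofReal_add (by positivity) (by positivity), add_halves]

end LowerBounds

/-! ### The kernel regression at neighbouring points -/

/-- The quantitative properties of the kernel in use: bounds on and off `[0, 1]` and a Lipschitz
constant on `[0, 1]`. The jump at `1` is not excluded. -/
structure KernelBounds (K : ℝ → ℝ) (k₁ k₂ k₃ : ℝ) : Prop where
  measurable : Measurable K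
  support : ∀ s, s ∉ Icc (0 : ℝ) 1 → K s = 0
  low_pos : 0 < k₁
  low : ∀ s ∈ Icc (0 : ℝ) 1, k₁ ≤ K s
  high_pos : 0 < k₂
  high : ∀ s, K s ≤ k₂
  nonneg : ∀ s, 0 ≤ K s
  lip_nonneg : 0 ≤ k₃
  lip : ∀ s ∈ Icc (0 : ℝ) 1, ∀ t ∈ Icc (0 : ℝ) 1, |K s - K t| ≤ k₃ * |s - t|

theorem KernelCondition.exists_bounds {K : ℝ → ℝ} (hK : KernelCondition K) :
    ∃ k₁ k₂ k₃, KernelBounds K k₁ k₂ k₃ := by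
  obtain ⟨k₃, hlip⟩ := hK.contDiffOn.exists_lipschitzOnWith one_ne_zero (convex_Icc 0 1)
    isCompact_Icc
  have hcont : ContinuousOn K (Icc 0 1) := hK.contDiffOn.continuousOn
  have hanti : AntitoneOn K (Icc 0 1) := by
    refine antitoneOn_of_deriv_nonpos (convex_Icc 0 1) hcont
      ((hK.contDiffOn.differentiableOn one_ne_zero).mono interior_subset) fun s hs => ?_
    have h1 := hK.deriv_nonpos s (interior_subset hs)
    rwa [derivWithin_of_mem_nhds (mem_interior_iff_mem_nhds.1 hs)] at h1
  have h01 : (0 : ℝ) ∈ Icc (0 : ℝ) 1 := ⟨le_rfl, zero_le_one⟩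
  have h11 : (1 : ℝ) ∈ Icc (0 : ℝ) 1 := ⟨zero_le_one, le_rfl⟩
  have hlow : ∀ s ∈ Icc (0 : ℝ) 1, K 1 ≤ K s := fun s hs => hanti hs h11 hs.2
  have hpos : 0 < K 0 := hK.pos_one.trans_le (hlow 0 h01)
  refine ⟨K 1, K 0, k₃, ⟨?_, hK.support, hK.pos_one, hlow, hpos, fun s => ?_, fun s => ?_,
    k₃.2, fun s hs t ht => ?_⟩⟩
  · refine measurable_of_restrict_of_restrict_compl (measurableSet_Icc (a := (0 : ℝ)) (b := 1))
      (continuousOn_iff_continuous_domRestrict.1 hcont).measurable ?_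
    have : (Icc (0 : ℝ) 1)ᶜ.domRestrict K = fun _ => 0 := by
      funext s; exact hK.support s s.2
    rw [this]
    exact measurable_const
  · by_cases hs : s ∈ Icc (0 : ℝ) 1
    · exact hanti h01 hs hs.1
    · rw [hK.support s hs]; exact hpos.le
  · by_cases hs : s ∈ Icc (0 : ℝ) 1
    · exact hK.pos_one.le.trans (hlow s hs)
    · rw [hK.support s hs]
  · simpa [Real.dist_eq] using hlip.dist_le_mul s hs t ht

section Deterministic

variable {H : Type*} [NormedAddCommGroup H] [NormedSpace ℝ H] {K : ℝ → ℝ} {k₁ k₂ k₃ : ℝ}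

omit [NormedSpace ℝ H] in
/-- Moving the centre of the kernel by `κ b` changes a weight by `O(κ)` inside the ball, and by
`O(1)` only on a shell of relative width `κ` around its boundary. -/
theorem KernelBounds.abs_sub_le (hK : KernelBounds K k₁ k₂ k₃) {x y z : H} {b κ : ℝ} (hb : 0 < b)
    (hκ : 0 < κ) (hxz : ‖x - z‖ ≤ κ * b) :
    |K (b⁻¹ * ‖y - x‖) - K (b⁻¹ * ‖y - z‖)|
      ≤ k₃ * κ * (Metric.closedBall z b).indicator (fun _ => (1 : ℝ)) y
        + k₂ * (Metric.closedBall z ((1 + κ) * b) \ Metric.closedBall z ((1 - κ) * b)).indicator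
          (fun _ => (1 : ℝ)) y := by
  have h1 : ‖y - x‖ ≤ ‖y - z‖ + κ * b := by
    calc ‖y - x‖ = ‖(y - z) - (x - z)‖ := by rw [sub_sub_sub_cancel_right]
      _ ≤ ‖y - z‖ + ‖x - z‖ := norm_sub_le _ _
      _ ≤ _ := by linarith
  have h2 : ‖y - z‖ ≤ ‖y - x‖ + κ * b := by
    calc ‖y - z‖ = ‖(y - x) + (x - z)‖ := by rw [sub_add_sub_cancel]
      _ ≤ ‖y - x‖ + ‖x - z‖ := norm_add_le _ _
      _ ≤ _ := by linarith
  have hmem : ∀ v : ℝ, 0 ≤ v → v ≤ b → b⁻¹ * v ∈ Icc (0 : ℝ) 1 := fun v h0 hv =>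
    ⟨by positivity, by rw [inv_mul_le_iff₀ hb]; linarith⟩
  have hnmem : ∀ v : ℝ, b < v → K (b⁻¹ * v) = 0 := fun v hv => by
    refine hK.support _ fun h => ?_
    have := h.2
    rw [inv_mul_le_iff₀ hb] at this
    linarith
  have hk₂ := hK.high_pos
  have hk₃ := hK.lip_nonneg
  have hB0 : 0 ≤ (Metric.closedBall z b).indicator (fun _ => (1 : ℝ)) y :=
    indicator_nonneg (fun _ _ => zero_le_one) _
  rcases le_or_gt ‖y - z‖ ((1 - κ) * b) with h | h
  · have hz : ‖y - z‖ ≤ b := by nlinarith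
    have hx : ‖y - x‖ ≤ b := by nlinarith
    have hin : y ∈ Metric.closedBall z b := by rwa [Metric.mem_closedBall, dist_eq_norm]
    have hnot : y ∉ Metric.closedBall z ((1 + κ) * b) \ Metric.closedBall z ((1 - κ) * b) :=
      fun hy => hy.2 (by rwa [Metric.mem_closedBall, dist_eq_norm])
    rw [indicator_of_mem hin, indicator_of_notMem hnot, mul_one, mul_zero, add_zero]
    refine (hK.lip _ (hmem _ (norm_nonneg _) hx) _ (hmem _ (norm_nonneg _) hz)).trans ?_
    rw [← mul_sub, abs_mul, abs_of_pos (inv_pos.2 hb)]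
    gcongr
    rw [inv_mul_le_iff₀ hb, abs_le]
    constructor <;> linarith
  · rcases le_or_gt ‖y - z‖ ((1 + κ) * b) with h' | h'
    · have hin : y ∈ Metric.closedBall z ((1 + κ) * b) \ Metric.closedBall z ((1 - κ) * b) := by
        rw [Set.mem_sdiff, Metric.mem_closedBall, Metric.mem_closedBall, dist_eq_norm, not_le]
        exact ⟨h', h⟩
      rw [indicator_of_mem hin, mul_one]
      have h3 : |K (b⁻¹ * ‖y - x‖) - K (b⁻¹ * ‖y - z‖)| ≤ k₂ := by
        rw [abs_le]
        constructor <;> linarith [hK.nonneg (b⁻¹ * ‖y - x‖), hK.nonneg (b⁻¹ * ‖y - z‖),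
          hK.high (b⁻¹ * ‖y - x‖), hK.high (b⁻¹ * ‖y - z‖)]
      have : 0 ≤ k₃ * κ * (Metric.closedBall z b).indicator (fun _ => (1 : ℝ)) y := by positivity
      linarith
    · rw [hnmem _ (show b < ‖y - x‖ by nlinarith), hnmem _ (show b < ‖y - z‖ by nlinarith),
        sub_zero, abs_zero]
      have : 0 ≤ (Metric.closedBall z ((1 + κ) * b) \ Metric.closedBall z ((1 - κ) * b)).indicator
        (fun _ => (1 : ℝ)) y := indicator_nonneg (fun _ _ => zero_le_one) _
      positivity

/-- The error of the kernel regression at `x` in terms of quantities attached to a nearby point `z`: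
a bias `L b`, the noise at `z`, and the noise picked up by moving the centre from `z` to `x`, all
relative to the number of observations in the ball of radius `b / 2` around `z`. -/
theorem KernelBounds.norm_average_sub_le (hK : KernelBounds K k₁ k₂ k₃) {x z G : H} {b κ L : ℝ}
    (hb : 0 < b) (hκ : κ ∈ Ioo (0 : ℝ) (1 / 2)) (hxz : ‖x - z‖ ≤ κ * b) (hL : 0 ≤ L)
    (s : Finset ℕ) (y g v : ℕ → H) (hg : ∀ t ∈ s, ‖g t - G‖ ≤ L * ‖y t - x‖) {a e₁ e₂ e₃ : ℝ}
    (ha : 0 < a)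
    (hN : a ≤ ∑ t ∈ s, (Metric.closedBall z (b / 2)).indicator (fun _ => (1 : ℝ)) (y t))
    (h₁ : ‖∑ t ∈ s, K (b⁻¹ * ‖y t - z‖) • v t‖ ≤ e₁)
    (h₂ : ∑ t ∈ s, (Metric.closedBall z b).indicator (fun _ => (1 : ℝ)) (y t) * ‖v t‖ ≤ e₂)
    (h₃ : ∑ t ∈ s, (Metric.closedBall z ((1 + κ) * b) \ Metric.closedBall z ((1 - κ) * b)).indicator
      (fun _ => (1 : ℝ)) (y t) * ‖v t‖ ≤ e₃) :
    ‖(∑ t ∈ s, K (b⁻¹ * ‖y t - x‖))⁻¹ • ∑ t ∈ s, K (b⁻¹ * ‖y t - x‖) • (g t + v t) - G‖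
      ≤ L * b + (e₁ + k₃ * κ * e₂ + k₂ * e₃) / (k₁ * a) := by
  have hk₁ := hK.low_pos
  have hk₂ := hK.high_pos
  have hk₃ := hK.lip_nonneg
  obtain ⟨hκ0, hκ1⟩ := hκ
  set w : ℕ → ℝ := fun t => K (b⁻¹ * ‖y t - x‖) with hw
  set W : ℝ := ∑ t ∈ s, w t with hW
  have hw0 : ∀ t, 0 ≤ w t := fun t => hK.nonneg _
  have hWa : k₁ * a ≤ W := by
    calc k₁ * a
        ≤ k₁ * ∑ t ∈ s, (Metric.closedBall z (b / 2)).indicator (fun _ => (1 : ℝ)) (y t) := by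
          gcongr
      _ ≤ W := by
          rw [Finset.mul_sum]
          refine Finset.sum_le_sum fun t _ => ?_
          by_cases h : y t ∈ Metric.closedBall z (b / 2)
          · rw [indicator_of_mem h, mul_one]
            refine hK.low _ ⟨by positivity, ?_⟩
            rw [inv_mul_le_iff₀ hb, mul_one]
            rw [Metric.mem_closedBall, dist_eq_norm] at h
            calc ‖y t - x‖ = ‖(y t - z) - (x - z)‖ := by rw [sub_sub_sub_cancel_right]
              _ ≤ ‖y t - z‖ + ‖x - z‖ := norm_sub_le _ _
              _ ≤ b := by nlinarith
          · rw [indicator_of_notMem h, mul_zero]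
            exact hw0 t
  have hW0 : 0 < W := lt_of_lt_of_le (by positivity) hWa
  have hsplit : W⁻¹ • ∑ t ∈ s, w t • (g t + v t) - G
      = W⁻¹ • ∑ t ∈ s, w t • (g t - G) + W⁻¹ • ∑ t ∈ s, w t • v t := by
    have hG : G = W⁻¹ • ∑ t ∈ s, w t • G := by
      rw [← Finset.sum_smul, smul_smul, inv_mul_cancel₀ hW0.ne', one_smul]
    nth_rewrite 1 [hG]
    rw [← smul_sub, ← smul_add, ← Finset.sum_sub_distrib, ← Finset.sum_add_distrib]
    congr 1
    refine Finset.sum_congr rfl fun t _ => ?_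
    rw [smul_add, smul_sub]
    abel
  have hbias : ‖∑ t ∈ s, w t • (g t - G)‖ ≤ W * (L * b) := by
    rw [hW, Finset.sum_mul]
    refine norm_sum_le_of_le _ fun t ht => ?_
    rw [norm_smul, Real.norm_of_nonneg (hw0 t)]
    by_cases h : ‖y t - x‖ ≤ b
    · exact mul_le_mul_of_nonneg_left ((hg t ht).trans (by gcongr)) (hw0 t)
    · have h0 : w t = 0 := by
        refine hK.support _ fun h' => h ?_
        have := h'.2
        rwa [inv_mul_le_iff₀ hb, mul_one] at this
      rw [h0, zero_mul, zero_mul]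
  have hnoise : ‖∑ t ∈ s, w t • v t‖ ≤ e₁ + k₃ * κ * e₂ + k₂ * e₃ := by
    have h4 : ∑ t ∈ s, w t • v t = ∑ t ∈ s, K (b⁻¹ * ‖y t - z‖) • v t
        + ∑ t ∈ s, (w t - K (b⁻¹ * ‖y t - z‖)) • v t := by
      rw [← Finset.sum_add_distrib]
      exact Finset.sum_congr rfl fun t _ => by rw [← add_smul, add_sub_cancel]
    have h5 : ‖∑ t ∈ s, (w t - K (b⁻¹ * ‖y t - z‖)) • v t‖ ≤ k₃ * κ * e₂ + k₂ * e₃ := by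
      calc ‖∑ t ∈ s, (w t - K (b⁻¹ * ‖y t - z‖)) • v t‖
          ≤ ∑ t ∈ s, (k₃ * κ * ((Metric.closedBall z b).indicator (fun _ => (1 : ℝ)) (y t) * ‖v t‖)
            + k₂ * ((Metric.closedBall z ((1 + κ) * b) \
              Metric.closedBall z ((1 - κ) * b)).indicator (fun _ => (1 : ℝ)) (y t) * ‖v t‖)) := by
            refine norm_sum_le_of_le _ fun t _ => ?_
            rw [norm_smul, Real.norm_eq_abs]
            have := mul_le_mul_of_nonneg_right (hK.abs_sub_le (y := y t) hb hκ0 hxz)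
              (norm_nonneg (v t))
            refine this.trans (le_of_eq ?_)
            ring
        _ ≤ k₃ * κ * e₂ + k₂ * e₃ := by
            rw [Finset.sum_add_distrib, ← Finset.mul_sum, ← Finset.mul_sum]
            gcongr
    rw [h4]
    refine (norm_add_le _ _).trans ?_
    linarith
  have he : 0 ≤ e₁ + k₃ * κ * e₂ + k₂ * e₃ := (norm_nonneg _).trans hnoise
  rw [hsplit]
  refine (norm_add_le _ _).trans ?_
  rw [norm_smul, norm_smul, norm_inv, Real.norm_of_nonneg hW0.le]
  refine add_le_add ?_ ?_
  · rw [inv_mul_le_iff₀ hW0]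
    exact hbias
  · rw [inv_mul_eq_div]
    exact div_le_div₀ he hnoise (by positivity) hWa

end Deterministic

section Exceptional

variable {Ω H : Type*} [MeasurableSpace Ω] {P : Measure Ω} [IsProbabilityMeasure P]
  [NormedAddCommGroup H] [MeasurableSpace H] [BorelSpace H] [SecondCountableTopology H]
  {Ψ : H → H} {X ε : ℤ → Ω → H}

/-- The exponential inequalities at one point of the net, off a common exceptional set. -/
theorem IsAutoregression.exists_exceptional_set (hA : IsAutoregression P Ψ X ε) {B₁ B₂ B₃ : Set H}
    (hB₁ : MeasurableSet B₁) (hB₂ : MeasurableSet B₂) (hB₃ : MeasurableSet B₃) {w : H → ℝ}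
    (hw : Measurable w) (hw01 : ∀ v, w v ∈ Icc (0 : ℝ) 1) {l m : ℝ} (hl : 0 < l) (hm : 0 ≤ m)
    (hnorm : ∫⁻ ω, ENNReal.ofReal (Real.exp (l * ‖ε 0 ω‖)) ∂P ≤ ENNReal.ofReal (1 + l * m))
    {ι : Type} [Fintype ι] {ξ : ι → H → ℝ} {ρ : ι → ℝ} {δ : ℝ} (hξ : ∀ i, Measurable (ξ i))
    (hρ : ∀ i, 0 < ρ i) (hδ : 0 ≤ δ)
    (hint : ∀ i, ∫⁻ ω, ENNReal.ofReal (Real.exp (ρ i * ξ i (ε 0 ω))) ∂P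
      ≤ ENNReal.ofReal (1 + ρ i * δ)) (n : ℕ) (s : ℝ) :
    ∃ N : Set Ω, P N ≤ (5 + Fintype.card ι : ℕ) * ENNReal.ofReal (Real.exp (-s)) ∧ ∀ ω ∉ N,
      (1 / 2 * ∑ t ∈ Finset.Icc 1 n, transitionProb P Ψ ε B₁ (X ((t : ℤ) - 1) ω) - s
        ≤ ∑ t ∈ Finset.Icc 1 n, B₁.indicator (fun _ => (1 : ℝ)) (X (t : ℤ) ω)) ∧
      (∑ t ∈ Finset.Icc 1 n, B₂.indicator (fun _ => (1 : ℝ)) (X (t : ℤ) ω)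
        ≤ 2 * ∑ t ∈ Finset.Icc 1 n, transitionProb P Ψ ε B₂ (X ((t : ℤ) - 1) ω) + s) ∧
      (∑ t ∈ Finset.Icc 1 n, B₃.indicator (fun _ => (1 : ℝ)) (X (t : ℤ) ω)
        ≤ 2 * ∑ t ∈ Finset.Icc 1 n, transitionProb P Ψ ε B₃ (X ((t : ℤ) - 1) ω) + s) ∧
      (∑ t ∈ Finset.Icc 1 n, B₂.indicator (fun _ => (1 : ℝ)) (X (t : ℤ) ω) * ‖ε ((t : ℤ) + 1) ω‖
        ≤ m * ∑ t ∈ Finset.Icc 1 n, B₂.indicator (fun _ => (1 : ℝ)) (X (t : ℤ) ω) + s / l) ∧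
      (∑ t ∈ Finset.Icc 1 n, B₃.indicator (fun _ => (1 : ℝ)) (X (t : ℤ) ω) * ‖ε ((t : ℤ) + 1) ω‖
        ≤ m * ∑ t ∈ Finset.Icc 1 n, B₃.indicator (fun _ => (1 : ℝ)) (X (t : ℤ) ω) + s / l) ∧
      ∀ i, ∑ t ∈ Finset.Icc 1 n, w (X (t : ℤ) ω) * ξ i (ε ((t : ℤ) + 1) ω)
        ≤ δ * ∑ t ∈ Finset.Icc 1 n, w (X (t : ℤ) ω) + s / ρ i := by
  have hind : ∀ B : Set H, ∀ v, B.indicator (fun _ => (1 : ℝ)) v ∈ Icc (0 : ℝ) 1 := by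
    intro B v
    by_cases h : v ∈ B <;> simp [h]
  set q := ENNReal.ofReal (Real.exp (-s)) with hq
  have key : ∀ {a b : Ω → ℝ}, P {ω | a ω < b ω} ≤ q → ∃ N, P N ≤ q ∧ ∀ ω ∉ N, b ω ≤ a ω :=
    fun h => ⟨_, h, fun ω hω => not_lt.1 hω⟩
  obtain ⟨N₁, p₁, g₁⟩ :=
    key (hA.measure_visits_lower hB₁ n s)
  obtain ⟨N₂, p₂, g₂⟩ :=
    key (hA.measure_visits_upper hB₂ n s)
  obtain ⟨N₃, p₃, g₃⟩ :=
    key (hA.measure_visits_upper hB₃ n s)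
  obtain ⟨N₄, p₄, g₄⟩ :=
    key (hA.measure_weighted_sum (measurable_const.indicator hB₂) (hind B₂) measurable_norm hl
      hnorm hm n s)
  obtain ⟨N₅, p₅, g₅⟩ :=
    key (hA.measure_weighted_sum (measurable_const.indicator hB₃) (hind B₃) measurable_norm hl
      hnorm hm n s)
  have p₆ := fun i => hA.measure_weighted_sum hw hw01 (hξ i) (hρ i) (hint i) hδ n s
  refine ⟨N₁ ∪ (N₂ ∪ (N₃ ∪ (N₄ ∪ (N₅ ∪ ⋃ i ∈ (Finset.univ : Finset ι),
    {ω | δ * ∑ t ∈ Finset.Icc 1 n, w (X (t : ℤ) ω) + s / ρ i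
      < ∑ t ∈ Finset.Icc 1 n, w (X (t : ℤ) ω) * ξ i (ε ((t : ℤ) + 1) ω)})))), ?_, fun ω hω => ?_⟩
  · calc _ ≤ q + (q + (q + (q + (q + ∑ _i : ι, q)))) := by
          refine (measure_union_le _ _).trans (add_le_add p₁ ?_)
          refine (measure_union_le _ _).trans (add_le_add p₂ ?_)
          refine (measure_union_le _ _).trans (add_le_add p₃ ?_)
          refine (measure_union_le _ _).trans (add_le_add p₄ ?_)
          refine (measure_union_le _ _).trans (add_le_add p₅ ?_)
          exact (measure_biUnion_finset_le _ _).trans (Finset.sum_le_sum fun i _ => p₆ i)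
      _ = _ := by
          rw [Finset.sum_const, Finset.card_univ, nsmul_eq_mul]
          push_cast
          ring
  · simp only [mem_union, not_or] at hω
    obtain ⟨h1, h2, h3, h4, h5, h6⟩ := hω
    refine ⟨g₁ ω h1, g₂ ω h2, g₃ ω h3, g₄ ω h4, g₅ ω h5, fun i => ?_⟩
    exact not_lt.1 fun h => h6 (mem_biUnion (Finset.mem_coe.2 (Finset.mem_univ i)) h)

end Exceptional

/-- The bandwidth conditions make the expected number of observations in a ball of radius `b_n`
large compared with `log n`. -/
theorem BandwidthCondition.eventually_log_le {φ : ℝ → ℝ} {α : ℝ} {h b : ℕ → ℝ} (hα : 0 < α)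
    (hband : BandwidthCondition φ α h b) (hφ : ∀ u > 0, 0 < φ u) {c : ℝ} (hc : 0 < c) :
    ∀ᶠ n : ℕ in atTop, Real.log n ≤ c * (n * φ (b n)) := by
  have hlog : Tendsto (fun n : ℕ => Real.log n) atTop atTop :=
    Real.tendsto_log_atTop.comp tendsto_natCast_atTop_atTop
  filter_upwards [hband.growth.eventually_ge_atTop 1,
    hband.phi_ratio.eventually (eventually_le_nhds one_pos), hlog.eventually_ge_atTop 1,
    hlog.eventually_ge_atTop (1 / c)] with n h1 h2 h3 h4
  set l := Real.log n with hl
  have hφh := hφ _ (hband.h_pos n)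
  have hφb := hφ _ (hband.b_pos n)
  have hl0 : 0 < l := by linarith
  have h5 : l ≤ Real.sqrt (n * φ (h n)) := by
    rw [Real.rpow_neg hl0.le, ← div_eq_mul_inv, one_le_div (by positivity)] at h1
    refine le_trans ?_ h1
    calc l = l ^ (1 : ℝ) := (Real.rpow_one l).symm
      _ ≤ l ^ (2 + α) := Real.rpow_le_rpow_of_exponent_le h3 (by linarith)
  have h6 : l ^ 2 ≤ n * φ (h n) := (Real.le_sqrt' hl0).1 h5
  have h7 : φ (h n) ≤ φ (b n) := by
    rw [div_mul_eq_mul_div, div_le_one hφb] at h2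
    exact (le_mul_of_one_le_right hφh.le (one_le_pow₀ h3)).trans h2
  have h8 : (n : ℝ) * φ (h n) ≤ n * φ (b n) := by gcongr
  have h9 : 1 ≤ c * l := by rwa [div_le_iff₀' hc] at h4
  calc l ≤ c * l ^ 2 := by nlinarith
    _ ≤ c * (n * φ (b n)) := by gcongr; linarith

/-! ### Uniform consistency for a fixed radius -/

section FixedRadius

variable {Ω : Type*} [MeasurableSpace Ω] {P : Measure Ω} [IsProbabilityMeasure P] {ν : Measure ℝ}
  {ε X : ℤ → Ω → L2 ν} {S : Submodule ℝ (L2 ν)} {Ψ : L2 ν → L2 ν} {D : Set ℝ} {α : ℝ}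
  {φ : ℝ → ℝ} {fε : L2 ν → ℝ} {gε : ℝ → L2 ν → ℝ} {h b : ℕ → ℝ} {x₀ : L2 ν}

theorem IsAutoregression.transitionProb_shell (hA : IsAutoregression P Ψ X ε) (z v : L2 ν)
    {u w : ℝ} (huw : u ≤ w) :
    transitionProb P Ψ ε (Metric.closedBall z w \ Metric.closedBall z u) v
      = smallBall P ε (z - Ψ v) w - smallBall P ε (z - Ψ v) u := by
  rw [← transitionProb_closedBall, ← transitionProb_closedBall]
  exact measureReal_sdiff (fun ω hω => Metric.closedBall_subset_closedBall huw hω)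
    (hA.measurableSet_transition Metric.isClosed_closedBall.measurableSet v)

/-- The probability of a visit to a thin shell is small unless the preceding state is large, in
which case it is at most the probability of a visit to the ball of twice the radius. -/
theorem IsAutoregression.transitionProb_shell_le (hA : IsAutoregression P Ψ X ε) {z v : L2 ν}
    {κ u M p q : ℝ} (hκ : κ ∈ Ioo (0 : ℝ) (1 / 2)) (hu : 0 < u) (hp : 0 ≤ p)
    (hsmall : ‖v‖ ≤ M →
      smallBall P ε (z - Ψ v) ((1 + κ) * u) - smallBall P ε (z - Ψ v) ((1 - κ) * u) ≤ p)
    (hlarge : smallBall P ε (z - Ψ v) (2 * u) ≤ q) :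
    transitionProb P Ψ ε (Metric.closedBall z ((1 + κ) * u) \ Metric.closedBall z ((1 - κ) * u)) v
      ≤ p + q * {y : L2 ν | M < ‖y‖}.indicator (fun _ => (1 : ℝ)) v := by
  obtain ⟨hκ0, hκ1⟩ := hκ
  rw [hA.transitionProb_shell z v (by nlinarith)]
  by_cases hM : M < ‖v‖
  · have hv : v ∈ {y : L2 ν | M < ‖y‖} := hM
    have h1 : smallBall P ε (z - Ψ v) ((1 + κ) * u) ≤ smallBall P ε (z - Ψ v) (2 * u) :=
      smallBall_mono_radius _ (by nlinarith)
    have h2 := smallBall_nonneg (P := P) (ε := ε) (z - Ψ v) ((1 - κ) * u)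
    rw [indicator_of_mem hv]
    linarith
  · have hv : v ∉ {y : L2 ν | M < ‖y‖} := hM
    rw [indicator_of_notMem hv, mul_zero, add_zero]
    exact hsmall (not_lt.1 hM)

/-- Consistency of the kernel estimator, uniformly over `S ∩ U(r)` with `r` fixed. On the scale
`n φ(b_n)` the number of observations near any point is bounded below, while the noise is small at
all points of a net of scale `κ b_n`; its size is at most `n`, so that the exponential inequalities
with deviation `2 log n` hold for all its points at once. -/
theorem IsStationaryFAR.eventually_measure_error_le [SecondCountableTopology (L2 ν)]
    (e : HilbertBasis ℕ ℝ (L2 ν)) (hX : IsStationaryFAR P S Ψ X ε)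
    (hS : ∀ x ∈ S, ∃ r : ℝ, x ∈ lipBall D ν r) {K : ℝ → ℝ} {k₁ k₂ k₃ : ℝ}
    (hK : KernelBounds K k₁ k₂ k₃) {L : ℝ≥0} (hΨ : LipschitzWith L Ψ) (hα : 0 < α)
    (hball : SmallBallCondition P D S Ψ X ε x₀ α φ fε gε h)
    (hmom : MomentCondition P e X ε x₀) (hband : BandwidthCondition φ α h b)
    (hreg : RegularSmallBalls (smallBall P ε) S (lipBall D ν) φ fε α)
    (hU : RecentringCondition D S Ψ) (r : ℝ) {δ η : ℝ} (hδ : 0 < δ) (hη : 0 < η) :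
    ∀ᶠ n : ℕ in atTop, P {ω | ¬ ∀ x ∈ (S : Set (L2 ν)) ∩ lipBall D ν r,
      ‖(∑ t ∈ Finset.Icc 1 n, K ((b n)⁻¹ * ‖X (t : ℤ) ω - x‖))⁻¹ •
        ∑ t ∈ Finset.Icc 1 n, K ((b n)⁻¹ * ‖X (t : ℤ) ω - x‖) • X ((t : ℤ) + 1) ω - Ψ x‖ ≤ δ}
      ≤ ENNReal.ofReal η := by
  have hΨm : Measurable Ψ := hΨ.continuous.measurable
  have hA := hX.isAutoregression hΨm
  obtain ⟨hKm, -, hk₁, -, hk₂, -, -, hk₃, -⟩ := id hK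
  obtain ⟨c, hc, hfX⟩ := hball.fX_pos r
  obtain ⟨E, hE, hdouble⟩ := hreg.doubling
  obtain ⟨B, hB, hupper⟩ := hreg.upper
  -- exponential moments of the innovations
  obtain ⟨Cm, Hm, hHm, hmoments⟩ := hmom.moments
  have hε0 := hX.measurable_innov 0
  have hexp := integrable_exp_of_moments (P := P) hε0.norm (fun ω => norm_nonneg (ε 0 ω))
    hX.innov_integrable.norm hHm hmoments
  have hl0 : (0 : ℝ) < (2 * Hm)⁻¹ := by positivity
  obtain ⟨l, hl, hnorm⟩ := exists_lintegral_exp_le hε0.norm one_pos hl0 hexp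
    (fun ω => by rw [abs_norm, one_mul]) le_rfl one_pos
  set m : ℝ := ∫ ω, ‖ε 0 ω‖ ∂P + 1 with hm
  have hm0 : 0 < m := by
    have : 0 ≤ ∫ ω, ‖ε 0 ω‖ ∂P := integral_nonneg fun ω => norm_nonneg _
    linarith
  -- the tolerances, all in units of `n φ(b_n)`
  set a : ℝ := c / (32 * E) with ha
  have ha0 : 0 < a := by positivity
  set q : ℝ := k₁ * a * δ / 8 with hq
  have hq0 : 0 < q := by positivity
  set δ₁ : ℝ := q / (8 * B * k₂) with hδ₁
  have hδ₁0 : 0 < δ₁ := by positivity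
  set δ₂ : ℝ := q / (2 * k₂ * m) with hδ₂
  have hδ₂0 : 0 < δ₂ := by positivity
  set A₂ : ℝ := 3 * B * m + 1 with hA₂
  have hA₂0 : 0 < A₂ := by positivity
  obtain ⟨ι, hι, ξ, ρ, hξ, hρ, hξint, hmajor⟩ :=
    exists_scalar_majorants e hε0 hX.innov_integrable hX.innov_mean hl0 hexp hδ₁0
  obtain ⟨M, -, hM⟩ := hX.exists_norm_bound (by positivity : 0 < δ₂ / (8 * B * E))
    (by positivity : 0 < η / 3)
  obtain ⟨r', hr'⟩ := hU r M
  obtain ⟨κ, hκ, hκ₀, hshell⟩ := hreg.shell r' (δ₂ / 8) (by positivity) (q / (k₃ * A₂ + 1))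
    (by positivity)
  obtain ⟨A, hnet⟩ := hX.exists_net hΨm hreg hU hc hfX hκ.1
  have hb : Tendsto b atTop (𝓝[>] 0) :=
    tendsto_nhdsWithin_iff.2 ⟨hband.b_lim, Eventually.of_forall hband.b_pos⟩
  have hb2 : Tendsto (fun n => b n / 2) atTop (𝓝[>] 0) := by
    have := (tendsto_const_mul_nhdsGT_zero (half_pos one_pos)).comp hb
    refine this.congr fun n => ?_
    simp only [Function.comp_apply]
    ring
  have hlog : ∀ c' > 0, ∀ᶠ n : ℕ in atTop, 2 * Real.log n ≤ c' * (n * φ (b n)) := by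
    intro c' hc'
    filter_upwards [hband.eventually_log_le hα hreg.phi_pos (half_pos hc')] with n hn
    linarith
  have hlogρ : ∀ᶠ n : ℕ in atTop, ∀ i, 2 * Real.log n / ρ i ≤ B * δ₁ * (n * φ (b n)) := by
    refine eventually_all.2 fun i => ?_
    filter_upwards [hlog (B * δ₁ * ρ i) (by have := hρ i; positivity)] with n hn
    rw [div_le_iff₀ (hρ i)]
    linarith
  have hlarge : ∀ᶠ n : ℕ in atTop, A ≤ n * φ (b n) := by
    filter_upwards [hband.eventually_log_le hα hreg.phi_pos one_pos,
      (Real.tendsto_log_atTop.comp tendsto_natCast_atTop_atTop).eventually_ge_atTop A] with n h1 h2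
    simp only [Function.comp_apply] at h2
    linarith
  have hLb : ∀ᶠ n : ℕ in atTop, (L : ℝ) * b n < δ / 2 := by
    have := hband.b_lim.const_mul (L : ℝ)
    rw [mul_zero] at this
    exact this.eventually (eventually_lt_nhds (half_pos hδ))
  have hunion : ∀ᶠ n : ℕ in atTop, ((5 + Fintype.card ι : ℕ) : ℝ) / n < η / 3 :=
    (tendsto_const_div_atTop_nhds_zero_nat _).eventually (eventually_lt_nhds (by positivity))
  have hrec : ∀ᵐ ω ∂P, ∀ t : ℤ, X t ω = Ψ (X (t - 1) ω) + ε t ω := ae_all_iff.2 hA.recursion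
  have hmemS : ∀ᵐ ω ∂P, ∀ t : ℤ, Ψ (X t ω) ∈ S := ae_all_iff.2 hX.ae_operator_mem
  filter_upwards [hX.eventually_le_sum_smallBall hΨm hα hS hball hband.h_pos hreg hU hc hfX hb2
      (by positivity : 0 < η / 3), hb2.eventually hdouble, hb.eventually hdouble,
    hb.eventually hupper, hb.eventually ((tendsto_const_mul_nhdsGT_zero two_pos).eventually hupper),
    hb.eventually hshell, hb.eventually hnet, hlog a ha0, hlog B hB, hlog (δ₂ / 2) (by positivity),
    hlog l hl, hlog (m * δ₂ * l) (by positivity), hlogρ, hlarge, hLb, hunion, eventually_gt_atTop 0]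
    with n hsum hdb2 hdb hup hup2 hsh hJ hs1 hs2 hs3 hs4 hs5 hs6 hlg hLbn hun hn
  obtain ⟨J, hJsub, hJcard, hJnet⟩ := hJ
  have hn0 : (0 : ℝ) < n := by exact_mod_cast hn
  have hbn := hband.b_pos n
  have hφ := hreg.phi_pos _ hbn
  set s : ℝ := 2 * Real.log n with hs
  set V : ℝ := n * φ (b n) with hV
  have hV0 : 0 < V := by positivity
  have hJn : (J.card : ℝ) ≤ n := le_of_mul_le_mul_right (hJcard.trans hlg) hφ
  have hmeasball : ∀ (z : L2 ν) (u : ℝ), MeasurableSet (Metric.closedBall z u) := fun z u =>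
    Metric.isClosed_closedBall.measurableSet
  have hwm : ∀ z : L2 ν, Measurable fun v : L2 ν => K ((b n)⁻¹ * ‖v - z‖) / k₂ := fun z =>
    (hKm.comp ((measurable_id.sub_const z).norm.const_mul _)).div_const _
  have hw01 : ∀ z v : L2 ν, K ((b n)⁻¹ * ‖v - z‖) / k₂ ∈ Icc (0 : ℝ) 1 := fun z v =>
    ⟨div_nonneg (hK.nonneg _) hk₂.le, by rw [div_le_one hk₂]; exact hK.high _⟩
  have hex := fun z : L2 ν => hA.exists_exceptional_set (hmeasball z (b n / 2))
    (hmeasball z (b n)) ((hmeasball z ((1 + κ) * b n)).diff (hmeasball z ((1 - κ) * b n)))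
    (hwm z) (hw01 z) hl hm0.le hnorm hξ hρ hδ₁0.le hξint n s
  choose N hN hgood using hex
  set I : L2 ν → ℝ := {y : L2 ν | M < ‖y‖}.indicator fun _ => (1 : ℝ) with hI
  set G₁ : Set Ω := {ω | ¬ ∀ x ∈ (S : Set (L2 ν)) ∩ lipBall D ν r,
      c / 8 * (n * φ (b n / 2)) ≤
        ∑ t ∈ Finset.Icc 1 n, smallBall P ε (x - Ψ (X ((t : ℤ) - 1) ω)) (b n / 2)} with hG₁
  set G₂ : Set Ω := {ω | δ₂ / (8 * B * E) * n
      < ∑ t ∈ Finset.Icc 1 n, I (X ((t : ℤ) - 1) ω)} with hG₂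
  have hPN : ∑ z ∈ J, P (N z) ≤ ENNReal.ofReal (η / 3) := by
    calc ∑ z ∈ J, P (N z)
        ≤ ∑ _z ∈ J, ((5 + Fintype.card ι : ℕ) : ℝ≥0∞) * ENNReal.ofReal (Real.exp (-s)) :=
          Finset.sum_le_sum fun z _ => hN z
      _ = ENNReal.ofReal (J.card * (((5 + Fintype.card ι : ℕ) : ℝ) * Real.exp (-s))) := by
          rw [Finset.sum_const, nsmul_eq_mul, ENNReal.ofReal_mul (by positivity),
            ENNReal.ofReal_mul (by positivity), ENNReal.ofReal_natCast, ENNReal.ofReal_natCast]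
      _ ≤ ENNReal.ofReal (η / 3) := by
          refine ENNReal.ofReal_le_ofReal (le_trans ?_ hun.le)
          have hexps : Real.exp (-s) = 1 / (n : ℝ) ^ 2 := by
            rw [hs, Real.exp_neg, mul_comm, Real.exp_mul, Real.exp_log hn0, one_div]
            norm_cast
          rw [hexps]
          calc J.card * (((5 + Fintype.card ι : ℕ) : ℝ) * (1 / (n : ℝ) ^ 2))
              ≤ n * (((5 + Fintype.card ι : ℕ) : ℝ) * (1 / (n : ℝ) ^ 2)) := by gcongr
            _ = ((5 + Fintype.card ι : ℕ) : ℝ) / n := by field_simp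
  calc P _ ≤ P (G₁ ∪ (G₂ ∪ ⋃ z ∈ J, N z)) := ?_
    _ ≤ ENNReal.ofReal (η / 3) + (ENNReal.ofReal (η / 3) + ENNReal.ofReal (η / 3)) := by
        refine (measure_union_le _ _).trans (add_le_add hsum ?_)
        refine (measure_union_le _ _).trans (add_le_add (hM n hn) ?_)
        exact (measure_biUnion_finset_le _ _).trans hPN
    _ = ENNReal.ofReal η := by
        rw [← ENNReal.ofReal_add (by positivity) (by positivity),
          ← ENNReal.ofReal_add (by positivity) (by positivity)]
        ring_nf
  refine measure_mono_ae ?_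
  filter_upwards [hrec, hmemS] with ω hω hωS hbad
  by_contra hcon
  have hcon' : ω ∉ G₁ ∪ (G₂ ∪ ⋃ z ∈ J, N z) := hcon
  rw [mem_union, mem_union, not_or, not_or] at hcon'
  obtain ⟨hg₁, hg₂, hg₃⟩ := hcon'
  have hg₁' : ∀ x ∈ (S : Set (L2 ν)) ∩ lipBall D ν r, c / 8 * (n * φ (b n / 2)) ≤
      ∑ t ∈ Finset.Icc 1 n, smallBall P ε (x - Ψ (X ((t : ℤ) - 1) ω)) (b n / 2) :=
    not_not.1 hg₁
  have hg₂' : ∑ t ∈ Finset.Icc 1 n, I (X ((t : ℤ) - 1) ω) ≤ δ₂ / (8 * B * E) * n := not_lt.1 hg₂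
  refine hbad fun x hx => ?_
  obtain ⟨z, hz, hxz⟩ := hJnet x hx
  have hzJ := hJsub hz
  have hωz : ω ∉ N z := fun hmem => hg₃ (mem_biUnion (Finset.mem_coe.2 hz) hmem)
  obtain ⟨i1, i2, i3, i4, i5, i6⟩ := hgood z ω hωz
  -- number of observations near `z`
  have hcount : a * V ≤ ∑ t ∈ Finset.Icc 1 n,
      (Metric.closedBall z (b n / 2)).indicator (fun _ => (1 : ℝ)) (X (t : ℤ) ω) := by
    simp only [transitionProb_closedBall] at i1
    have h1 := hg₁' z hzJ
    rw [show 2 * (b n / 2) = b n by ring] at hdb2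
    have h2 : 4 * a * V ≤ c / 8 * (n * φ (b n / 2)) := by
      calc 4 * a * V = c / (8 * E) * (n * φ (b n)) := by rw [ha, hV]; ring
        _ ≤ c / (8 * E) * (n * (E * φ (b n / 2))) := by gcongr
        _ = c / 8 * (n * φ (b n / 2)) := by field_simp
    linarith
  have hball_le : ∑ t ∈ Finset.Icc 1 n,
      (Metric.closedBall z (b n)).indicator (fun _ => (1 : ℝ)) (X (t : ℤ) ω) ≤ 3 * B * V := by
    have h1 : ∑ t ∈ Finset.Icc 1 n,
        transitionProb P Ψ ε (Metric.closedBall z (b n)) (X ((t : ℤ) - 1) ω) ≤ B * V := by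
      calc _ ≤ ∑ _t ∈ Finset.Icc 1 n, B * φ (b n) := by
            refine Finset.sum_le_sum fun t _ => ?_
            rw [transitionProb_closedBall]
            exact hup _
        _ = B * V := by
            rw [Finset.sum_const, Nat.card_Icc, add_tsub_cancel_right, nsmul_eq_mul, hV]
            ring
    linarith
  have hshell_le : ∑ t ∈ Finset.Icc 1 n,
      (Metric.closedBall z ((1 + κ) * b n) \ Metric.closedBall z ((1 - κ) * b n)).indicator
        (fun _ => (1 : ℝ)) (X (t : ℤ) ω) ≤ δ₂ * V := by
    have h1 : ∑ t ∈ Finset.Icc 1 n, transitionProb P Ψ ε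
        (Metric.closedBall z ((1 + κ) * b n) \ Metric.closedBall z ((1 - κ) * b n))
        (X ((t : ℤ) - 1) ω) ≤ δ₂ / 4 * V := by
      calc _ ≤ ∑ t ∈ Finset.Icc 1 n,
            (δ₂ / 8 * φ (b n) + B * (E * φ (b n)) * I (X ((t : ℤ) - 1) ω)) := by
            refine Finset.sum_le_sum fun t _ => ?_
            refine hA.transitionProb_shell_le hκ hbn (by positivity) (fun hle => ?_)
              ((hup2 _).trans (by gcongr))
            exact hsh _ ⟨S.sub_mem hzJ.1 (hωS _), hr' z hzJ _ (hX.process_mem _ ω) hle⟩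
        _ = (n * (δ₂ / 8) + B * E * ∑ t ∈ Finset.Icc 1 n, I (X ((t : ℤ) - 1) ω)) * φ (b n) := by
            rw [Finset.sum_add_distrib, Finset.sum_const, Nat.card_Icc,
              add_tsub_cancel_right, nsmul_eq_mul, ← Finset.mul_sum]
            ring
        _ ≤ (n * (δ₂ / 8) + B * E * (δ₂ / (8 * B * E) * n)) * φ (b n) := by gcongr
        _ = δ₂ / 4 * V := by rw [hV]; field_simp; norm_num
    linarith
  -- noise at `z` and noise picked up when moving to `x`
  have hsl1 : s / l ≤ V := by rw [div_le_iff₀ hl]; linarith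
  have hsl2 : s / l ≤ m * δ₂ * V := by rw [div_le_iff₀ hl]; linarith
  have he₂ : ∑ t ∈ Finset.Icc 1 n, (Metric.closedBall z (b n)).indicator (fun _ => (1 : ℝ))
      (X (t : ℤ) ω) * ‖ε ((t : ℤ) + 1) ω‖ ≤ A₂ * V := by
    have := mul_le_mul_of_nonneg_left hball_le hm0.le
    rw [hA₂]
    linarith
  have he₃ : ∑ t ∈ Finset.Icc 1 n,
      (Metric.closedBall z ((1 + κ) * b n) \ Metric.closedBall z ((1 - κ) * b n)).indicator
        (fun _ => (1 : ℝ)) (X (t : ℤ) ω) * ‖ε ((t : ℤ) + 1) ω‖ ≤ 2 * m * δ₂ * V := by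
    have := mul_le_mul_of_nonneg_left hshell_le hm0.le
    linarith
  have hweight : ∑ t ∈ Finset.Icc 1 n, K ((b n)⁻¹ * ‖X (t : ℤ) ω - z‖) / k₂ ≤ 3 * B * V := by
    refine le_trans (Finset.sum_le_sum fun t _ => ?_) hball_le
    by_cases hin : X (t : ℤ) ω ∈ Metric.closedBall z (b n)
    · rw [indicator_of_mem hin]
      exact (hw01 z _).2
    · rw [indicator_of_notMem hin, hK.support _ fun h' => hin ?_, zero_div]
      have := h'.2
      rw [inv_mul_le_iff₀ hbn, mul_one] at this
      rwa [Metric.mem_closedBall, dist_eq_norm]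
  have he₁ : ‖∑ t ∈ Finset.Icc 1 n, K ((b n)⁻¹ * ‖X (t : ℤ) ω - z‖) • ε ((t : ℤ) + 1) ω‖
      ≤ q * V := by
    have h1 := hmajor (Finset.Icc 1 n) (fun t => K ((b n)⁻¹ * ‖X (t : ℤ) ω - z‖) / k₂)
      (fun t => ε ((t : ℤ) + 1) ω) (4 * B * δ₁ * V) (fun t _ => (hw01 z _).1) fun i => by
        have h2 := i6 i
        have h3 := mul_le_mul_of_nonneg_left hweight hδ₁0.le
        have h4 := hs6 i
        linarith
    have h5 : ∑ t ∈ Finset.Icc 1 n, K ((b n)⁻¹ * ‖X (t : ℤ) ω - z‖) • ε ((t : ℤ) + 1) ω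
        = k₂ • ∑ t ∈ Finset.Icc 1 n,
          (K ((b n)⁻¹ * ‖X (t : ℤ) ω - z‖) / k₂) • ε ((t : ℤ) + 1) ω := by
      rw [Finset.smul_sum]
      refine Finset.sum_congr rfl fun t _ => ?_
      rw [smul_smul, mul_div_cancel₀ _ hk₂.ne']
    rw [h5, norm_smul, Real.norm_of_nonneg hk₂.le]
    calc _ ≤ k₂ * (2 * (4 * B * δ₁ * V)) := by gcongr
      _ = q * V := by rw [hδ₁]; field_simp; norm_num
  have hmain := hK.norm_average_sub_le (G := Ψ x) hbn hκ hxz L.coe_nonneg (Finset.Icc 1 n)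
    (fun t : ℕ => X (t : ℤ) ω) (fun t : ℕ => Ψ (X (t : ℤ) ω)) (fun t : ℕ => ε ((t : ℤ) + 1) ω)
    (fun t _ => by simpa [dist_eq_norm] using hΨ.dist_le_mul (X (t : ℤ) ω) x)
    (by positivity : 0 < a * V) hcount he₁ he₂ he₃
  have hX1 : ∀ t : ℕ, Ψ (X (t : ℤ) ω) + ε ((t : ℤ) + 1) ω = X ((t : ℤ) + 1) ω := fun t => by
    rw [hω ((t : ℤ) + 1), add_sub_cancel_right]
  simp only [hX1] at hmain
  refine hmain.trans ?_
  have hκA : k₃ * κ * (A₂ * V) ≤ q * V := by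
    have h1 : k₃ * κ * A₂ ≤ q := by
      calc k₃ * κ * A₂ ≤ (k₃ * A₂ + 1) * κ := by linarith [hκ.1]
        _ ≤ (k₃ * A₂ + 1) * (q / (k₃ * A₂ + 1)) := by gcongr
        _ = q := by field_simp
    calc _ = k₃ * κ * A₂ * V := by ring
      _ ≤ q * V := by gcongr
  have hk₂e : k₂ * (2 * m * δ₂ * V) = q * V := by rw [hδ₂]; field_simp
  have hfin : (q * V + k₃ * κ * (A₂ * V) + k₂ * (2 * m * δ₂ * V)) / (k₁ * (a * V)) ≤ δ / 2 := by
    rw [div_le_iff₀ (by positivity), hk₂e]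
    have h1 : δ / 2 * (k₁ * (a * V)) = 4 * q * V := by rw [hq]; ring
    rw [h1]
    linarith [mul_pos hq0 hV0]
  linarith

end FixedRadius

/-! ### Balls of Lipschitz functions and the choice of the radii -/

section LipschitzBalls

theorem secondCountableTopology_L2 (ν : Measure ℝ) [IsFiniteMeasure ν] :
    SecondCountableTopology (L2 ν) := by
  have : Fact ((2 : ℝ≥0∞) ≠ ∞) := ⟨ENNReal.ofNat_ne_top⟩
  infer_instance

theorem HasPositiveDensityOn.ae_mem {D : Set ℝ} {ν : Measure ℝ} (hν : HasPositiveDensityOn D ν)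
    (hD : MeasurableSet D) : ∀ᵐ u ∂ν, u ∈ D := by
  obtain ⟨p, -, -, rfl⟩ := hν
  exact withDensity_absolutelyContinuous _ _ (ae_restrict_mem hD)

theorem HasPositiveDensityOn.measure_univ_pos {D : Set ℝ} {ν : Measure ℝ}
    (hν : HasPositiveDensityOn D ν) (hD : MeasurableSet D) (hint : (interior D).Nonempty) :
    0 < ν univ := by
  obtain ⟨p, hp, hpos, rfl⟩ := hν
  rw [withDensity_apply _ MeasurableSet.univ, Measure.restrict_univ, pos_iff_ne_zero]
  intro h0
  rw [lintegral_eq_zero_iff hp] at h0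
  have hfalse : ∀ᵐ _u ∂(volume.restrict D), False := by
    filter_upwards [h0, ae_restrict_mem hD] with u h1 h2
    exact (hpos u h2).ne' h1
  have hzero : (volume.restrict D) univ = 0 := by simpa [ae_iff] using hfalse
  rw [Measure.restrict_apply_univ] at hzero
  exact (isOpen_interior.measure_pos volume hint).ne' (measure_mono_null interior_subset hzero)

theorem supNormOn_sub_le (D : Set ℝ) (f g : ℝ → ℝ) :
    supNormOn D (f - g) ≤ supNormOn D f + supNormOn D g := by
  refine iSup₂_le fun u hu => ?_
  refine enorm_sub_le.trans (add_le_add ?_ ?_)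
  · exact le_iSup₂ (f := fun u (_ : u ∈ D) => ‖f u‖ₑ) u hu
  · exact le_iSup₂ (f := fun u (_ : u ∈ D) => ‖g u‖ₑ) u hu

theorem enorm_sub_div_le_lipNormOn {D : Set ℝ} (f : ℝ → ℝ) {u v : ℝ} (hu : u ∈ D) (hv : v ∈ D)
    (huv : u ≠ v) : ‖f u - f v‖ₑ / ‖u - v‖ₑ ≤ lipNormOn D f :=
  le_iSup₂_of_le u hu (le_iSup₂_of_le v hv (le_iSup_of_le huv le_rfl))

theorem lipNormOn_sub_le (D : Set ℝ) (f g : ℝ → ℝ) :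
    lipNormOn D (f - g) ≤ lipNormOn D f + lipNormOn D g := by
  refine iSup₂_le fun u hu => iSup₂_le fun v hv => iSup_le fun huv => ?_
  have h1 : (f - g) u - (f - g) v = (f u - f v) - (g u - g v) := by
    simp only [Pi.sub_apply]; ring
  rw [h1]
  calc ‖(f u - f v) - (g u - g v)‖ₑ / ‖u - v‖ₑ
      ≤ (‖f u - f v‖ₑ + ‖g u - g v‖ₑ) / ‖u - v‖ₑ := by gcongr; exact enorm_sub_le
    _ = ‖f u - f v‖ₑ / ‖u - v‖ₑ + ‖g u - g v‖ₑ / ‖u - v‖ₑ := ENNReal.add_div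
    _ ≤ _ := add_le_add (enorm_sub_div_le_lipNormOn f hu hv huv)
        (enorm_sub_div_le_lipNormOn g hu hv huv)

theorem abs_sub_le_of_lipNormOn_le {D : Set ℝ} {f : ℝ → ℝ} {C : ℝ≥0} (hf : lipNormOn D f ≤ C)
    {u v : ℝ} (hu : u ∈ D) (hv : v ∈ D) : |f u - f v| ≤ C * |u - v| := by
  rcases eq_or_ne u v with rfl | huv
  · simp
  have h1 := (enorm_sub_div_le_lipNormOn f hu hv huv).trans hf
  have h0 : ‖u - v‖ₑ ≠ 0 := by rw [enorm_ne_zero]; exact sub_ne_zero.2 huv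
  rw [ENNReal.div_le_iff h0 enorm_ne_top] at h1
  have h2 : ‖f u - f v‖₊ ≤ C * ‖u - v‖₊ := by
    rw [enorm_eq_nnnorm, enorm_eq_nnnorm] at h1
    exact_mod_cast h1
  exact_mod_cast h2

/-- A function with values above `a` on `D` has a large norm in `L²(ν)`. -/
theorem exists_abs_le_of_norm_le {D : Set ℝ} {ν : Measure ℝ} [IsFiniteMeasure ν]
    (hmem : ∀ᵐ u ∂ν, u ∈ D) (hpos : 0 < ν univ) (M : ℝ) :
    ∃ a : ℝ, 0 ≤ a ∧ ∀ (y : L2 ν) (f : ℝ → ℝ), (y : ℝ → ℝ) =ᵐ[ν] f → ‖y‖ ≤ M →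
      ∃ u ∈ D, |f u| ≤ a := by
  set κ : ℝ := (ν univ).toReal ^ (1 / 2 : ℝ) with hκ
  have hκ0 : 0 < κ := Real.rpow_pos_of_pos (ENNReal.toReal_pos hpos.ne' (measure_ne_top _ _)) _
  refine ⟨(|M| + 1) / κ, by positivity, fun y f hyf hy => ?_⟩
  by_contra! hcon
  have h1 : eLpNorm (fun _ : ℝ => (|M| + 1) / κ) 2 ν ≤ eLpNorm y 2 ν := by
    refine eLpNorm_mono_ae ?_
    filter_upwards [hyf, hmem] with u h2 h3
    rw [h2, Real.norm_of_nonneg (by positivity), Real.norm_eq_abs]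
    exact (hcon u h3).le
  have hν : ν ≠ 0 := fun h => by simp [h] at hpos
  rw [eLpNorm_const _ two_ne_zero hν] at h1
  have h2 := ENNReal.toReal_mono (Lp.eLpNorm_ne_top y) h1
  rw [← Lp.norm_def, ENNReal.toReal_mul, ← ENNReal.toReal_rpow, toReal_enorm,
    Real.norm_of_nonneg (by positivity), ENNReal.toReal_ofNat, ← hκ,
    div_mul_cancel₀ _ hκ0.ne'] at h2
  linarith [le_abs_self M]

/-- A bound on `‖Ψ v‖` in `L²(ν)` bounds a Lipschitz version of `Ψ v` at some point of `D`, hence on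
all of `D`, since `D` is bounded. -/
theorem OperatorCondition.recentringCondition {D : Set ℝ} {ν : Measure ℝ} [IsFiniteMeasure ν]
    (hD : IsCompact D) (hint : (interior D).Nonempty) (hν : HasPositiveDensityOn D ν)
    {S : Submodule ℝ (L2 ν)} {Ψ : L2 ν → L2 ν} (hΨ : OperatorCondition D S Ψ) :
    RecentringCondition D S Ψ := by
  intro r M
  obtain ⟨L, hL⟩ := hΨ.lipschitz
  obtain ⟨C, hC⟩ := hΨ.lip_bound
  obtain ⟨a, ha, hex⟩ := exists_abs_le_of_norm_le (hν.ae_mem hD.measurableSet)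
    (hν.measure_univ_pos hD.measurableSet hint) (‖Ψ 0‖ + L * M)
  set d : ℝ := Metric.diam D with hd
  have hd0 : 0 ≤ d := Metric.diam_nonneg
  refine ⟨max r 0 + (a + C * d) + C, fun x hx v hv hvM => ?_⟩
  obtain ⟨g, hgc, hxg, hg⟩ := hx.2
  obtain ⟨f, hfc, hvf, hf⟩ := hC v hv
  have hnorm : ‖Ψ v‖ ≤ ‖Ψ 0‖ + L * M := by
    have h1 := hL.dist_le_mul v 0
    rw [dist_eq_norm, dist_zero_right] at h1
    calc ‖Ψ v‖ = ‖Ψ 0 + (Ψ v - Ψ 0)‖ := by rw [add_sub_cancel]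
      _ ≤ ‖Ψ 0‖ + ‖Ψ v - Ψ 0‖ := norm_add_le _ _
      _ ≤ ‖Ψ 0‖ + L * M := by
          have := mul_le_mul_of_nonneg_left hvM L.coe_nonneg
          linarith
  obtain ⟨u₀, hu₀, hfu₀⟩ := hex (Ψ v) f hvf hnorm
  have hsup : supNormOn D f ≤ ENNReal.ofReal (a + C * d) := by
    refine iSup₂_le fun u hu => ?_
    rw [Real.enorm_eq_ofReal_abs]
    refine ENNReal.ofReal_le_ofReal ?_
    have h1 := abs_sub_le_of_lipNormOn_le hf hu hu₀
    have h2 : |u - u₀| ≤ d := by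
      rw [← Real.dist_eq]
      exact Metric.dist_le_diam_of_mem hD.isBounded hu hu₀
    have h3 : |f u| ≤ |f u - f u₀| + |f u₀| := by
      have := abs_add_le (f u - f u₀) (f u₀)
      rwa [sub_add_cancel] at this
    have h4 : (C : ℝ) * |u - u₀| ≤ C * d := by gcongr
    linarith
  refine ⟨g - f, hgc.sub hfc, ?_, ?_⟩
  · filter_upwards [Lp.coeFn_sub x (Ψ v), hxg, hvf] with u h1 h2 h3
    rw [h1, Pi.sub_apply, Pi.sub_apply, h2, h3]
  · calc supNormOn D (g - f) + lipNormOn D (g - f)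
        ≤ (supNormOn D g + supNormOn D f) + (lipNormOn D g + lipNormOn D f) :=
          add_le_add (supNormOn_sub_le D g f) (lipNormOn_sub_le D g f)
      _ = (supNormOn D g + lipNormOn D g) + supNormOn D f + lipNormOn D f := by ring
      _ ≤ ENNReal.ofReal (max r 0) + ENNReal.ofReal (a + C * d) + ENNReal.ofReal C := by
          gcongr
          · exact hg.trans (ENNReal.ofReal_le_ofReal (le_max_left _ _))
          · rwa [ENNReal.ofReal_coe_nnreal]
      _ = ENNReal.ofReal (max r 0 + (a + C * d) + C) := by
          rw [← ENNReal.ofReal_add (le_max_right _ _) (by positivity),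
            ← ENNReal.ofReal_add (by positivity) (by positivity)]

end LipschitzBalls

/-- Diagonal sequences: if each `a k` tends to `0`, then so does `n ↦ a (k n) n` for some `k` that
tends to infinity slowly enough. -/
theorem exists_slow_diagonal {a : ℕ → ℕ → ℝ≥0∞} (ha : ∀ k, Tendsto (a k) atTop (𝓝 0)) :
    ∃ k : ℕ → ℕ, Tendsto k atTop atTop ∧ Tendsto (fun n => a (k n) n) atTop (𝓝 0) := by
  have hex : ∀ k : ℕ, ∃ N, ∀ n ≥ N, a k n ≤ ((k : ℝ≥0∞) + 1)⁻¹ := fun k =>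
    eventually_atTop.1 ((ENNReal.tendsto_nhds_zero.1 (ha k)) _ (by simp))
  choose N hN using hex
  let k : ℕ → ℕ := fun n => Nat.findGreatest (fun j => N j ≤ n) n
  have hk : Tendsto k atTop atTop := by
    refine tendsto_atTop.2 fun j => ?_
    filter_upwards [eventually_ge_atTop (max j (N j))] with n hn
    exact Nat.le_findGreatest (le_of_max_le_left hn) (le_of_max_le_right hn)
  refine ⟨k, hk, ?_⟩
  have hinv : Tendsto (fun n => ((k n : ℝ≥0∞) + 1)⁻¹) atTop (𝓝 0) := by
    have h1 : Tendsto (fun j : ℕ => ((j : ℝ≥0∞) + 1)⁻¹) atTop (𝓝 0) := by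
      have := (tendsto_add_atTop_iff_nat 1).2 ENNReal.tendsto_inv_nat_nhds_zero
      simpa using this
    exact h1.comp hk
  refine tendsto_of_tendsto_of_tendsto_of_le_of_le' tendsto_const_nhds hinv
    (Eventually.of_forall fun _ => zero_le) ?_
  filter_upwards [hk.eventually_ge_atTop 1] with n hn
  have hspec : N (k n) ≤ n := Nat.findGreatest_of_ne_zero (P := fun j => N j ≤ n) (n := n) rfl
    (by omega)
  exact hN _ n hspec

end FAR
end

theorem corollaryA3
    {Ω : Type*} [MeasurableSpace Ω] (P : Measure Ω) [IsProbabilityMeasure P]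
    -- the domain, the measure on it, and the space of smooth functions
    (D : Set ℝ) (hD_convex : Convex ℝ D) (hD_compact : IsCompact D)
    (hD_interior : (interior D).Nonempty)
    (ν : Measure ℝ) [IsFiniteMeasure ν] (hν : FAR.HasPositiveDensityOn D ν)
    (e : HilbertBasis ℕ ℝ (FAR.L2 ν))
    (S : Submodule ℝ (FAR.L2 ν)) (hS : ∀ x ∈ S, ∃ r : ℝ, x ∈ FAR.lipBall D ν r)
    -- the model
    (Ψ : FAR.L2 ν → FAR.L2 ν) (X ε : ℤ → Ω → FAR.L2 ν) (hX : FAR.IsStationaryFAR P S Ψ X ε)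
    (K : ℝ → ℝ) (hK : FAR.KernelCondition K)
    (hΨ : FAR.OperatorCondition D S Ψ)
    (x₀ : FAR.L2 ν) (hx₀ : x₀ ∈ S) (α : ℝ) (hα : 0 < α)
    (φ : ℝ → ℝ) (fε : FAR.L2 ν → ℝ) (gε : ℝ → FAR.L2 ν → ℝ) (h b : ℕ → ℝ)
    (hball : FAR.SmallBallCondition P D S Ψ X ε x₀ α φ fε gε h)
    (hmom : FAR.MomentCondition P e X ε x₀)
    (hband : FAR.BandwidthCondition φ α h b) :
    ∃ r : ℕ → ℝ, (∀ n, 0 < r n) ∧ Tendsto r atTop atTop ∧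
      ∀ δ : ℝ, 0 < δ →
        Tendsto
          (fun n : ℕ => P {ω | ENNReal.ofReal δ <
            ⨆ x ∈ (S : Set (FAR.L2 ν)) ∩ FAR.lipBall D ν (r n),
              ‖FAR.kernelEstimator D S K X (r n) n (b n) ω x - Ψ x‖ₑ})
          atTop (𝓝 0) := by
  have := FAR.secondCountableTopology_L2 ν
  obtain ⟨L, hL⟩ := hΨ.lipschitz
  obtain ⟨k₁, k₂, k₃, hKb⟩ := hK.exists_bounds
  have hreg := hball.regularSmallBalls hX hS hx₀ hα
  have hU := hΨ.recentringCondition hD_compact hD_interior hν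
  -- Radius `k + 1` and tolerance `1 / (k + 1)` are diagonalised together.
  let a : ℕ → ℕ → ℝ≥0∞ := fun k n => P {ω | ENNReal.ofReal (1 / ((k : ℝ) + 1)) <
    ⨆ x ∈ (S : Set (FAR.L2 ν)) ∩ FAR.lipBall D ν ((k : ℝ) + 1),
      ‖FAR.kernelEstimator D S K X ((k : ℝ) + 1) n (b n) ω x - Ψ x‖ₑ}
  have ha : ∀ k, Tendsto (a k) atTop (𝓝 0) := by
    intro k
    refine ENNReal.tendsto_nhds_zero.2 fun η hη => ?_
    obtain ⟨η', hη'0, hη'⟩ := ENNReal.lt_iff_exists_nnreal_btwn.1 hη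
    have hη'pos : (0 : ℝ) < η' := by exact_mod_cast hη'0
    have hk : (0 : ℝ) < 1 / ((k : ℝ) + 1) := by positivity
    filter_upwards [hX.eventually_measure_error_le e hS hKb hL hα hball hmom hband hreg hU
      ((k : ℝ) + 1) hk hη'pos] with n hn
    rw [ENNReal.ofReal_coe_nnreal] at hn
    refine le_trans (measure_mono fun ω hω => ?_) (hn.trans hη'.le)
    by_contra hcon
    have hgood := not_not.1 hcon
    have hω' : ENNReal.ofReal (1 / ((k : ℝ) + 1)) <
      ⨆ x ∈ (S : Set (FAR.L2 ν)) ∩ FAR.lipBall D ν ((k : ℝ) + 1),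
        ‖FAR.kernelEstimator D S K X ((k : ℝ) + 1) n (b n) ω x - Ψ x‖ₑ := hω
    refine absurd hω' (not_lt.2 (iSup₂_le fun x hx => ?_))
    rw [FAR.kernelEstimator, if_pos hx, ← ofReal_norm]
    exact ENNReal.ofReal_le_ofReal (hgood x hx)
  obtain ⟨k, hk, hlim⟩ := FAR.exists_slow_diagonal ha
  have hkr : Tendsto (fun n => (k n : ℝ) + 1) atTop atTop :=
    tendsto_atTop_add_const_right _ _ (tendsto_natCast_atTop_atTop.comp hk)
  refine ⟨fun n => (k n : ℝ) + 1, fun n => by positivity, hkr, fun δ hδ => ?_⟩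
  refine tendsto_of_tendsto_of_tendsto_of_le_of_le' tendsto_const_nhds hlim
    (Eventually.of_forall fun _ => zero_le) ?_
  filter_upwards [hkr.eventually_ge_atTop (1 / δ)] with n hn
  refine measure_mono fun ω hω => ?_
  have hω' : ENNReal.ofReal δ < ⨆ x ∈ (S : Set (FAR.L2 ν)) ∩ FAR.lipBall D ν ((k n : ℝ) + 1),
    ‖FAR.kernelEstimator D S K X ((k n : ℝ) + 1) n (b n) ω x - Ψ x‖ₑ := hω
  refine lt_of_le_of_lt (ENNReal.ofReal_le_ofReal ?_) hω'
  rw [div_le_iff₀ (by positivity)]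
  rw [div_le_iff₀' hδ] at hn
  exact hn
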